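/- Let $K$ be a field of characteristic $0$ and $V$ a finite-dimensional $\mathbb Z$-graded $K$-vector space; write $|x|$ for the degree in $V$ and $\deg x=|x|-1$ for the degree in the shifted space $V[1]$. All signs below follow the Koszul rule for $\deg$, scalars having degree $0$. A $k$-linear form $\Omega$ on $V[1]$ is cyclic if $\Omega(x_k,x_1,\dots,x_{k-1})=\pm\,\Omega(x_1,\dots,x_k)$; $\mathcal C(V)=\bigoplus_{k\ge 0}\mathcal C^k$ is the space of cyclic forms ($\mathcal C^0=K$). For a $k$-linear form $A$ put $A^{Cycl}=\sum_\tau A^\tau$, the sum over the cyclic group generated by $(1,2,\dots,k)$, with $A^\tau(x_1,\dots,x_k)=\pm A(x_{\tau^{-1}(1)},\dots,x_{\tau^{-1}(k)})$, and $A\odot B=(A\otimes B)^{Cycl}$. Let $b$ be a (graded) symmetric, non-degenerate bilinear form of degree $0$ on $V$: $b(x,y)=(-1)^{|x||y|}b(y,x)$ for homogeneous $x,y$, and $b(x,y)=0$ unless $|x|+|y|=0$. Let $(e_i)$ be a homogeneous basis of $V$ and $(e'_i)$ the basis with $b(e_i,e'_j)=\delta_{ij}$. The Pinczon bracket associated to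 $b$ is the bilinear bracket $$\{\Omega,\Omega'\}=\sum_i \iota_{e_i}\Omega\odot\iota_{e'_i}\Omega'$$ for $\Omega\in\mathcal C^{k+1}$, $\Omega'\in\mathcal C^{k'+1}$, $k,k'\ge0$, and $\{\mathcal C^0,\mathcal C(V)\}=\{\mathcal C(V),\mathcal C^0\}=0$. Explicitly, for homogeneous arguments, $$\{\Omega,\Omega'\}=\sum_i (F_i)^{Cycl},\qquad F_i(x_1,\dots,x_{k+k'})=(-1)^{\deg\Omega'\,(\deg x_1+\dots+\deg x_k+\deg e_i)}\;\Omega(x_1,\dots,x_k,e_i)\;\Omega'(e'_i,x_{k+1},\dots,x_{k+k'}).$$ A form $\Omega\in\mathcal C^{k+1}$ vanishes on shuffle products if for all $0<p<k$ and all $x_1,\dots,x_k,y$ $$\sum_{\sigma\in Sh(p,k-p)}\pm\,\Omega(x_{\sigma^{-1}(1)},\dots,x_{\sigma^{-1}(k)},y)=0,$$ where $Sh(p,k-p)$ is the set of permutations $\sigma$ with $\sigma(1)<\dots<\sigma(p)$ and $\sigma(p+1)<\dots<\sigma(k)$; scalars are regarded as vanishing on shuffle products. Let $\mathcal C_{vsp}(V)\subset\mathcal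 C(V)$ be the space of (sums of) cyclic forms vanishing on shuffle products. Then $\mathcal C(V)$ is closed under $\{\ ,\ \}$, and $\mathcal C_{vsp}(V)$ is a Lie subalgebra of $(\mathcal C(V),\{\ ,\ \})$, that is, a linear subspace with $\{\mathcal C_{vsp}(V),\mathcal C_{vsp}(V)\}\subset\mathcal C_{vsp}(V)$. -/

import Mathlib

namespace CyclicForms

/-- `n`-linear forms on `V`, regarded as `n`-linear forms on the shifted space `V[1]`
(which has the same underlying vector space). -/
abbrev Form (K V : Type*) [Field K] [AddCommGroup V] [Module K V] (n : ℕ) : Type _ :=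
  MultilinearMap K (fun _ : Fin n => V) K

/-- The parity of the shifted degree `deg x = |x| - 1` of an element `x` of degree `|x| = d`. -/
def parity (d : ℤ) : ZMod 2 := ((d - 1 : ℤ) : ZMod 2)

/-- The sign `(-1) ^ a`. -/
def sgn (K : Type*) [Field K] (a : ZMod 2) : K := if a = 0 then 1 else -1

/-- The Koszul sign of the permutation `σ` that moves the `i`-th letter to the place `σ i`, where
the `i`-th letter has parity `q i`: each pair of odd letters that is interchanged contributes
`-1`. -/
def koszulSign (K : Type*) [Field K] {n : ℕ} (q : Fin n → ZMod 2) (σ : Equiv.Perm (Fin n)) : K :=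
  ∏ i : Fin n, ∏ j : Fin n, if i < j ∧ σ j < σ i then sgn K (q i * q j) else 1

section Graded

variable {K V : Type*} [Field K] [AddCommGroup V] [Module K V]
  (𝒱 : ℤ → Submodule K V) [DirectSum.Decomposition 𝒱]

/-- The projection of `V` onto the sum of all `𝒱 d` whose shifted degree has parity `p`. -/
noncomputable def parityProj (p : ZMod 2) : V →ₗ[K] V :=
  (DirectSum.toModule K ℤ V
    (fun d => if parity d = p then (𝒱 d).subtype else 0)).comp
    (DirectSum.decomposeLinearEquiv 𝒱).toLinearMap

/-- The multilinear form whose value at homogeneous vectors `x i` with parities `q i` is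
`s q * F x`. -/
noncomputable def signed {n : ℕ} (s : (Fin n → ZMod 2) → K) (F : Form K V n) : Form K V n :=
  ∑ q : Fin n → ZMod 2, s q • F.compLinearMap (fun i => parityProj 𝒱 (q i))

/-- The action of permutations on forms, with the Koszul rule: at homogeneous vectors,
`(Ω ^ σ) (x_1, …, x_n) = ± Ω (x_{σ⁻¹ 1}, …, x_{σ⁻¹ n})`. -/
noncomputable def permAct {n : ℕ} (σ : Equiv.Perm (Fin n)) (F : Form K V n) : Form K V n :=
  signed 𝒱 (fun q => koszulSign K q σ) (F.domDomCongr σ.symm)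

open Classical in
/-- `Ω ^ Cycl`, the sum of all `Ω ^ τ` where `τ` runs through the cyclic group generated by
the cycle `(1, 2, …, n)`. -/
noncomputable def cyclicize {n : ℕ} (F : Form K V n) : Form K V n :=
  ∑ τ : Equiv.Perm (Fin n) with τ ∈ Subgroup.zpowers (finRotate n), permAct 𝒱 τ F

/-- The product `(x_1, …, x_{m+n}) ↦ A (x_1, …, x_m) * B (x_{m+1}, …, x_{m+n})`, without sign. -/
noncomputable def plainProd {m n : ℕ} (A : Form K V m) (B : Form K V n) : Form K V (m + n) :=
  ((LinearMap.mul' K K).compMultilinearMap (A.domCoprod B)).domDomCongr finSumFinEquiv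

/-- For `e` and `e'` homogeneous, both of shifted parity `p`, the form `ι_e A ⊗ ι_{e'} B` with the
Koszul rule. At homogeneous `X = (x_1, …, x_k)` and `Y = (y_1, …, y_l)` its value is
`(-1) ^ (deg B * (deg X + deg e)) * A (X, e) * B (e', Y)`, the sign being that of the passage from
the order `A, B, X, e, e', Y` to the order `A, X, e, B, e', Y`. As scalars have degree `0`, only
the component of `B` of degree `-(deg e' + deg Y)` contributes, whence the sign below. -/
noncomputable def contractProd {k l : ℕ} (p : ZMod 2) (e e' : V)
    (A : Form K V (k + 1)) (B : Form K V (l + 1)) : Form K V (k + l) :=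
  signed 𝒱
    (fun q => sgn K ((p + ∑ j : Fin l, q (Fin.natAdd k j)) * (∑ i : Fin k, q (Fin.castAdd l i) + p)))
    (plainProd ((LinearMap.applyₗ e).compMultilinearMap A.curryRight) (B.curryLeft e'))

variable {ι : Type*} [Fintype ι]

/-- `∑ i, ι_{e_i} A ⊙ ι_{e'_i} B`, where `⊙` is the cyclic product `(· ⊗ ·) ^ Cycl`, and `e i` and
`e' i` both have shifted parity `parity (d i)`. -/
noncomputable def pieceFun (e e' : ι → V) (d : ι → ℤ) {k l : ℕ}
    (A : Form K V (k + 1)) (B : Form K V (l + 1)) : Form K V (k + l) :=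
  ∑ i : ι, cyclicize 𝒱 (contractProd 𝒱 (parity (d i)) (e i) (e' i) A B)

end Graded

section Linearity

variable {K V : Type*} [Field K] [AddCommGroup V] [Module K V]
  (𝒱 : ℤ → Submodule K V) [DirectSum.Decomposition 𝒱]

theorem signed_add {n : ℕ} (s : (Fin n → ZMod 2) → K) (F G : Form K V n) :
    signed 𝒱 s (F + G) = signed 𝒱 s F + signed 𝒱 s G := by
  ext x
  simp [signed, mul_add, Finset.sum_add_distrib]

theorem signed_smul {n : ℕ} (s : (Fin n → ZMod 2) → K) (c : K) (F : Form K V n) :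
    signed 𝒱 s (c • F) = c • signed 𝒱 s F := by
  ext x
  simp [signed, Finset.mul_sum, mul_left_comm]

theorem cyclicize_add {n : ℕ} (F G : Form K V n) :
    cyclicize 𝒱 (F + G) = cyclicize 𝒱 F + cyclicize 𝒱 G := by
  have h : ∀ σ : Equiv.Perm (Fin n),
      permAct 𝒱 σ (F + G) = permAct 𝒱 σ F + permAct 𝒱 σ G := by
    intro σ
    unfold permAct
    rw [← signed_add]
    rfl
  simp only [cyclicize, h, Finset.sum_add_distrib]

theorem cyclicize_smul {n : ℕ} (c : K) (F : Form K V n) :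
    cyclicize 𝒱 (c • F) = c • cyclicize 𝒱 F := by
  have h : ∀ σ : Equiv.Perm (Fin n), permAct 𝒱 σ (c • F) = c • permAct 𝒱 σ F := by
    intro σ
    unfold permAct
    rw [← signed_smul]
    rfl
  simp only [cyclicize, h, Finset.smul_sum]

theorem plainProd_apply {m n : ℕ} (A : Form K V m) (B : Form K V n) (x : Fin (m + n) → V) :
    plainProd A B x = A (fun i => x (Fin.castAdd n i)) * B (fun j => x (Fin.natAdd m j)) := by
  simp [plainProd]

theorem contractProd_add_left {k l : ℕ} (p : ZMod 2) (e e' : V)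
    (A A' : Form K V (k + 1)) (B : Form K V (l + 1)) :
    contractProd 𝒱 p e e' (A + A') B
      = contractProd 𝒱 p e e' A B + contractProd 𝒱 p e e' A' B := by
  unfold contractProd
  rw [← signed_add]
  congr 1
  ext x
  simp [plainProd_apply, add_mul]

theorem contractProd_smul_left {k l : ℕ} (p : ZMod 2) (e e' : V) (c : K)
    (A : Form K V (k + 1)) (B : Form K V (l + 1)) :
    contractProd 𝒱 p e e' (c • A) B = c • contractProd 𝒱 p e e' A B := by
  unfold contractProd
  rw [← signed_smul]
  congr 1
  ext x
  simp [plainProd_apply, mul_assoc]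

theorem contractProd_add_right {k l : ℕ} (p : ZMod 2) (e e' : V)
    (A : Form K V (k + 1)) (B B' : Form K V (l + 1)) :
    contractProd 𝒱 p e e' A (B + B')
      = contractProd 𝒱 p e e' A B + contractProd 𝒱 p e e' A B' := by
  unfold contractProd
  rw [← signed_add]
  congr 1
  ext x
  simp [plainProd_apply, mul_add]

theorem contractProd_smul_right {k l : ℕ} (p : ZMod 2) (e e' : V) (c : K)
    (A : Form K V (k + 1)) (B : Form K V (l + 1)) :
    contractProd 𝒱 p e e' A (c • B) = c • contractProd 𝒱 p e e' A B := by
  unfold contractProd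
  rw [← signed_smul]
  congr 1
  ext x
  simp [plainProd_apply, mul_left_comm]

end Linearity

section Bracket

variable {K V : Type*} [Field K] [AddCommGroup V] [Module K V]
  (𝒱 : ℤ → Submodule K V) [DirectSum.Decomposition 𝒱]
  {ι : Type*} [Fintype ι]

/-- `pieceFun` as a bilinear map. -/
noncomputable def piece (e e' : ι → V) (d : ι → ℤ) (k l : ℕ) :
    Form K V (k + 1) →ₗ[K] Form K V (l + 1) →ₗ[K] Form K V (k + l) :=
  LinearMap.mk₂ K (fun A B => pieceFun 𝒱 e e' d A B)
    (fun A A' B => by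
      simp only [pieceFun, contractProd_add_left, cyclicize_add, Finset.sum_add_distrib])
    (fun c A B => by
      simp only [pieceFun, contractProd_smul_left, cyclicize_smul, Finset.smul_sum])
    (fun A B B' => by
      simp only [pieceFun, contractProd_add_right, cyclicize_add, Finset.sum_add_distrib])
    (fun c A B => by
      simp only [pieceFun, contractProd_smul_right, cyclicize_smul, Finset.smul_sum])

/-- All multilinear forms on `V[1]`. -/
abbrev Forms (K V : Type*) [Field K] [AddCommGroup V] [Module K V] : Type _ :=
  DirectSum ℕ (fun n => Form K V n)

/-- The bracket of an `m`-linear and an `n`-linear form; it is `0` if `m = 0` or `n = 0`. -/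
noncomputable def bracketPiece (e e' : ι → V) (d : ι → ℤ) :
    (m n : ℕ) → Form K V m →ₗ[K] Form K V n →ₗ[K] Forms K V
  | 0, _ => 0
  | _ + 1, 0 => 0
  | k + 1, l + 1 =>
      (piece 𝒱 e e' d k l).compr₂ (DirectSum.lof K ℕ (fun n => Form K V n) (k + l))

/-- The bracket `{Ω, Ω'} = ∑ i, ι_{e_i} Ω ⊙ ι_{e'_i} Ω'`, extended bilinearly to sums of forms with
different numbers of arguments. -/
noncomputable def bracket (e e' : ι → V) (d : ι → ℤ) :
    Forms K V →ₗ[K] Forms K V →ₗ[K] Forms K V :=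
  DirectSum.toModule K ℕ _ (fun m =>
    (DirectSum.toModule K ℕ _ (fun n => (bracketPiece 𝒱 e e' d m n).flip)).flip)

end Bracket

section Subspaces

variable {K V : Type*} [Field K] [AddCommGroup V] [Module K V] (𝒱 : ℤ → Submodule K V)

/-- `Ω (x_n, x_1, …, x_{n-1}) = Ω (x_1, …, x_n)` with the Koszul rule. -/
def IsCyclic {n : ℕ} (F : Form K V n) : Prop :=
  ∀ (d : Fin n → ℤ) (x : Fin n → V), (∀ i, x i ∈ 𝒱 (d i)) →
    koszulSign K (fun i => parity (d i)) (finRotate n) * F (fun i => x ((finRotate n).symm i))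
      = F x

/-- The set of `(p, k - p)`-shuffles: the permutations of `1, …, k` that are increasing on the first
`p` and on the last `k - p` numbers. -/
def shuffles (k p : ℕ) : Finset (Equiv.Perm (Fin k)) :=
  {σ | (∀ i j : Fin k, i < j → (j : ℕ) < p → σ i < σ j) ∧
       (∀ i j : Fin k, i < j → p ≤ (i : ℕ) → σ i < σ j)}

/-- A `(k+1)`-linear form vanishes on shuffle products if for every `y` the `k`-linear form
`(x_1, …, x_k) ↦ Ω (x_1, …, x_k, y)` vanishes at all
`sh_{p,k-p}(x_1 ⊗ ⋯ ⊗ x_k) = ∑ ± x_{σ⁻¹ 1} ⊗ ⋯ ⊗ x_{σ⁻¹ k}`, `0 < p < k`. Scalars, the `0`-linear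
forms, satisfy the condition trivially. -/
def VanishesOnShuffles : {n : ℕ} → Form K V n → Prop
  | 0, _ => True
  | k + 1, F =>
    ∀ (p : ℕ), 0 < p → p < k →
      ∀ (d : Fin k → ℤ) (x : Fin k → V), (∀ i, x i ∈ 𝒱 (d i)) → ∀ y : V,
        ∑ σ ∈ shuffles k p, koszulSign K (fun i => parity (d i)) σ *
          F (Fin.snoc (α := fun _ => V) (fun i => x (σ.symm i)) y) = 0

/-- The space `𝒞(V)` of cyclic forms on `V[1]`. -/
def cyclicForms : Submodule K (Forms K V) where
  carrier := {Ω | ∀ n, IsCyclic 𝒱 (Ω n)}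
  zero_mem' := by
    intro n d x _
    simp
  add_mem' := by
    intro Ω Ω' h h' n d x hx
    have h1 := h n d x hx
    have h2 := h' n d x hx
    simp only [DirectSum.add_apply, MultilinearMap.add_apply, mul_add, h1, h2]
  smul_mem' := by
    intro c Ω h n d x hx
    have h1 := h n d x hx
    simp only [DirectSum.smul_apply, MultilinearMap.smul_apply, smul_eq_mul]
    rw [mul_left_comm, h1]

/-- The space `𝒞_vsp(V)` of cyclic forms on `V[1]` that vanish on shuffle products. -/
def vspForms : Submodule K (Forms K V) where
  carrier := {Ω | Ω ∈ cyclicForms 𝒱 ∧ ∀ n, VanishesOnShuffles 𝒱 (Ω n)}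
  zero_mem' := by
    refine ⟨Submodule.zero_mem _, fun n => ?_⟩
    cases n with
    | zero => trivial
    | succ k =>
      intro p _ _ d x _ y
      simp
  add_mem' := by
    rintro Ω Ω' ⟨h, g⟩ ⟨h', g'⟩
    refine ⟨Submodule.add_mem _ h h', fun n => ?_⟩
    cases n with
    | zero => trivial
    | succ k =>
      intro p hp hpk d x hx y
      have h1 := g (k + 1) p hp hpk d x hx y
      have h2 := g' (k + 1) p hp hpk d x hx y
      simp only [DirectSum.add_apply, MultilinearMap.add_apply, mul_add, Finset.sum_add_distrib,
        h1, h2, add_zero]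
  smul_mem' := by
    rintro c Ω ⟨h, g⟩
    refine ⟨Submodule.smul_mem _ c h, fun n => ?_⟩
    cases n with
    | zero => trivial
    | succ k =>
      intro p hp hpk d x hx y
      have h1 := g (k + 1) p hp hpk d x hx y
      simp only [DirectSum.smul_apply, MultilinearMap.smul_apply, smul_eq_mul]
      simp only [mul_left_comm _ c, ← Finset.mul_sum, h1, mul_zero]

end Subspaces

end CyclicForms

/-! Cyclicity of the bracket is automatic, since every homogeneous piece is a sum of cyclicized
forms. The content is the vanishing on shuffle products, and it holds for each index `i` of the sum
separately.

Write `A`, `B` for the two forms, `c`, `c'` for `e_i`, `e'_i`, and evaluate at a word `X` followed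
by a fixed last letter `y`. In the cyclic sum `y` falls either to `B` or to `A`. Rotating the
arguments of `A` and `B` by their cyclicity turns the terms of the first kind into the sum of `± A
(m, c) * B (u, c', v, y)` over `X = u m v`: the block `m` is replaced by the single letter `c'`. The
second kind is the same with the two forms exchanged (`evalWord_cyclicize_contractProd`).

Replacing blocks by a letter, weighted by a function that kills shuffles and the empty word, is a
derivation of the shuffle product (`shuffleSum_insertSum`). So it sends a shuffle of nonempty words
to a combination of shuffles of nonempty words, which the outer form kills. If the weight lives on
the empty word only (a linear form), the operation is the shuffle with one letter, which the outer
form kills as well (`VanishesOnShuffleSums.insertSum`).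

The argument is carried out on words of homogeneous vectors, where shuffles and deconcatenations are
recursive. Forms need not be homogeneous, so the inserted function is first split by parity. -/

namespace CyclicForms

/-! ### Signs indexed by parities. -/

section Sign

variable {K : Type*} [Field K]

@[simp] theorem sgn_zero : sgn K 0 = 1 := by simp [sgn]

theorem sgn_add (a b : ZMod 2) : sgn K (a + b) = sgn K a * sgn K b := by
  have h : ∀ c : ZMod 2, c = 0 ∨ c = 1 := by decide
  have h' : (1 : ZMod 2) + 1 = 0 := by decide
  rcases h a with rfl | rfl <;> rcases h b with rfl | rfl <;> simp [sgn, h']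

@[simp] theorem sgn_mul_sgn_self (a : ZMod 2) : sgn K a * sgn K a = 1 := by
  rw [← sgn_add, CharTwo.add_self_eq_zero, sgn_zero]

end Sign

/-! ### Signed shuffles, deconcatenation and block insertion on words. -/

section Words

variable {K L : Type*} [Field K] (q : L → ZMod 2)

/-- The parity of a word. -/
def wordParity (w : List L) : ZMod 2 := (w.map q).sum

@[simp] theorem wordParity_nil : wordParity q [] = 0 := rfl

@[simp] theorem wordParity_cons (a : L) (w : List L) :
    wordParity q (a :: w) = q a + wordParity q w := by simp [wordParity]

@[simp] theorem wordParity_append (u v : List L) :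
    wordParity q (u ++ v) = wordParity q u + wordParity q v := by simp [wordParity]

theorem wordParity_perm {u v : List L} (h : u.Perm v) : wordParity q u = wordParity q v :=
  (h.map q).sum_eq

/-- The sum of `f u v` over all decompositions `w = u ++ v`. -/
def splitSum (w : List L) (f : List L → List L → K) : K :=
  ∑ j ∈ Finset.range (w.length + 1), f (w.take j) (w.drop j)

@[simp] theorem splitSum_nil (f : List L → List L → K) : splitSum [] f = f [] [] := by
  simp [splitSum]

theorem splitSum_cons (a : L) (w : List L) (f : List L → List L → K) :
    splitSum (a :: w) f = f [] (a :: w) + splitSum w (fun u v => f (a :: u) v) := by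
  rw [splitSum, List.length_cons, Finset.sum_range_succ', add_comm]
  simp [splitSum]

theorem splitSum_congr (w : List L) {f g : List L → List L → K}
    (h : ∀ u v, u ++ v = w → f u v = g u v) : splitSum w f = splitSum w g :=
  Finset.sum_congr rfl fun _ _ => h _ _ (List.take_append_drop _ _)

theorem splitSum_add (w : List L) (f g : List L → List L → K) :
    splitSum w (fun u v => f u v + g u v) = splitSum w f + splitSum w g :=
  Finset.sum_add_distrib

theorem splitSum_mul (w : List L) (c : K) (f : List L → List L → K) :
    splitSum w (fun u v => c * f u v) = c * splitSum w f :=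
  (Finset.mul_sum _ _ _).symm

theorem splitSum_eq_zero (w : List L) {f : List L → List L → K}
    (h : ∀ u v, u ++ v = w → f u v = 0) : splitSum w f = 0 :=
  Finset.sum_eq_zero fun _ _ => h _ _ (List.take_append_drop _ _)

theorem splitSum_eq_head (w : List L) {f : List L → List L → K}
    (h : ∀ u v, u ≠ [] → f u v = 0) : splitSum w f = f [] w := by
  cases w with
  | nil => simp
  | cons a w =>
    rw [splitSum_cons, splitSum_eq_zero w fun u v _ => h _ _ (by simp), add_zero]

/-- A cut falls either before or after `y`. In the bracket this decides which of the two forms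
receives `y`. -/
theorem splitSum_append_cons (v : List L) (y : L) (u : List L) (f : List L → List L → K) :
    splitSum (v ++ y :: u) f
      = splitSum v (fun m r => f m (r ++ y :: u)) + splitSum u (fun m r => f (v ++ y :: m) r) := by
  induction v generalizing f with
  | nil => simp [splitSum_cons]
  | cons a v ih => simp [splitSum_cons, ih, add_assoc]

theorem splitSum_assoc (w : List L) (f : List L → List L → List L → K) :
    splitSum w (fun u v => splitSum u fun u₁ u₂ => f u₁ u₂ v)
      = splitSum w (fun u v => splitSum v fun v₁ v₂ => f u v₁ v₂) := by
  induction w generalizing f with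
  | nil => simp
  | cons a w ih => simp [splitSum_cons, ih, splitSum_add, add_assoc]

/-- The sum of `± f w` over all shuffles `w` of `X` and `Y`, with the Koszul rule. -/
def shuffleSum : List L → List L → (List L → K) → K
  | [], Y, f => f Y
  | a :: X, [], f => f (a :: X)
  | a :: X, b :: Y, f => shuffleSum X (b :: Y) (fun w => f (a :: w)) +
      sgn K (q b * (q a + wordParity q X)) * shuffleSum (a :: X) Y (fun w => f (b :: w))
termination_by X Y => X.length + Y.length

@[simp] theorem shuffleSum_nil_left (Y : List L) (f : List L → K) :
    shuffleSum q [] Y f = f Y := by rw [shuffleSum]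

@[simp] theorem shuffleSum_nil_right (X : List L) (f : List L → K) :
    shuffleSum q X [] f = f X := by cases X <;> rw [shuffleSum]

theorem shuffleSum_cons_cons (a : L) (X : List L) (b : L) (Y : List L) (f : List L → K) :
    shuffleSum q (a :: X) (b :: Y) f = shuffleSum q X (b :: Y) (fun w => f (a :: w)) +
      sgn K (q b * (q a + wordParity q X)) * shuffleSum q (a :: X) Y (fun w => f (b :: w)) := by
  rw [shuffleSum]

theorem shuffleSum_add (X Y : List L) (f g : List L → K) :
    shuffleSum q X Y (fun w => f w + g w) = shuffleSum q X Y f + shuffleSum q X Y g := by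
  induction X, Y, f using shuffleSum.induct generalizing g with
  | case1 => simp
  | case2 => simp
  | case3 a X b Y f ih1 ih2 => simp only [shuffleSum_cons_cons, ih1, ih2]; ring

theorem shuffleSum_mul (X Y : List L) (c : K) (f : List L → K) :
    shuffleSum q X Y (fun w => c * f w) = c * shuffleSum q X Y f := by
  induction X, Y, f using shuffleSum.induct with
  | case1 => simp
  | case2 => simp
  | case3 a X b Y f ih1 ih2 => simp only [shuffleSum_cons_cons, ih1, ih2]; ring

theorem shuffleSum_congr (X Y : List L) {f g : List L → K}
    (h : ∀ w, w.Perm (X ++ Y) → f w = g w) : shuffleSum q X Y f = shuffleSum q X Y g := by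
  induction X, Y, f using shuffleSum.induct generalizing g with
  | case1 Y f => simpa using h Y (by simp)
  | case2 a X f => simpa using h (a :: X) (by simp)
  | case3 a X b Y f ih1 ih2 =>
    rw [shuffleSum_cons_cons, shuffleSum_cons_cons,
      ih1 fun w hw => h _ (by simpa using hw),
      ih2 fun w hw => h _ ((hw.cons b).trans List.perm_middle.symm)]

theorem shuffleSum_zero (X Y : List L) : shuffleSum q X Y (fun _ => (0 : K)) = 0 := by
  simpa using shuffleSum_mul q X Y (0 : K) (fun _ => 0)

theorem shuffleSum_eq_zero (X Y : List L) {f : List L → K}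
    (h : ∀ w, w.Perm (X ++ Y) → f w = 0) : shuffleSum q X Y f = 0 := by
  rw [shuffleSum_congr q X Y h, shuffleSum_zero]

/-- Deconcatenation is multiplicative for the shuffle product. -/
theorem shuffleSum_splitSum (X Y : List L) (f : List L → List L → K) :
    shuffleSum q X Y (fun w => splitSum w f)
      = splitSum X fun X₁ X₂ => splitSum Y fun Y₁ Y₂ =>
          sgn K (wordParity q X₂ * wordParity q Y₁) *
            shuffleSum q X₁ Y₁ (fun u => shuffleSum q X₂ Y₂ (f u)) := by
  induction X generalizing Y f with
  | nil => simp
  | cons a X ihX =>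
    induction Y generalizing f with
    | nil => simp
    | cons b Y ihY =>
      rw [shuffleSum_cons_cons]
      simp only [splitSum_cons, shuffleSum_add]
      rw [ihX, ihY]
      simp only [splitSum_cons, splitSum_add]
      simp only [wordParity_nil, mul_zero, sgn_zero, one_mul, shuffleSum_nil_left,
        shuffleSum_nil_right, wordParity_cons, shuffleSum_cons_cons, mul_add,
        mul_comm (q a + wordParity q X) (q b), splitSum_add, ← splitSum_mul, ← mul_assoc, ← sgn_add]
      -- The letter `b` passes all of `a :: X`; as `X = u ++ v`, this is passing `a :: u` and then
      -- `v`.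
      have e1 : splitSum X (fun u v => splitSum Y fun u' v' =>
            sgn K (q b * (q a + wordParity q X) + wordParity q v * wordParity q u') *
              shuffleSum q (a :: u) u' fun u₁ => shuffleSum q v v' (f (b :: u₁)))
          = splitSum X (fun u v => splitSum Y fun u' v' =>
            sgn K (wordParity q v * q b + wordParity q v * wordParity q u' +
              (q b * q a + q b * wordParity q u)) *
              shuffleSum q (a :: u) u' fun u₁ => shuffleSum q v v' (f (b :: u₁))) := by
        refine splitSum_congr _ fun u v h => splitSum_congr _ fun u' v' _ => ?_
        subst h
        congr 2
        simp only [wordParity_append]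
        ring
      simp only [mul_add] at e1
      linear_combination e1

/-- The sum of `± A m * B (u ++ c :: v)` over all decompositions `w = u ++ m ++ v`, where the sign
is that of an operator of parity `α` passing `u`. -/
def insertSum (α : ZMod 2) (A : List L → K) (c : L) (B : List L → K) (w : List L) : K :=
  splitSum w fun u w' => splitSum w' fun m v =>
    sgn K (α * wordParity q u) * (A m * B (u ++ c :: v))

/-- `A` vanishes on the shuffle products of nonempty words. -/
def VanishesOnShuffleSums (A : List L → K) : Prop :=
  ∀ X Y : List L, X ≠ [] → Y ≠ [] → shuffleSum q X Y A = 0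

variable {q} {α : ZMod 2} {A : List L → K} {c : L}

/-- Either the replaced block starts at the front of the word, or the operator of parity `α` first
passes `a`. -/
theorem insertSum_cons (B : List L → K) (a : L) (w : List L) :
    insertSum q α A c B (a :: w) = splitSum (a :: w) (fun m v => A m * B (c :: v)) +
      sgn K (α * q a) * insertSum q α A c (fun w => B (a :: w)) w := by
  rw [insertSum, splitSum_cons]
  simp [insertSum, ← splitSum_mul, mul_add, sgn_add, mul_assoc]

theorem insertSum_nil (hA : A [] = 0) (B : List L → K) : insertSum q α A c B [] = 0 := by
  simp [insertSum, hA]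

/-- By `hα`, replacing a block by `c` shifts the parity by `α`, and the new word contains `c`; so
only nonempty words of the shifted parity matter. -/
theorem insertSum_congr (hα : ∀ m, A m ≠ 0 → wordParity q m = α + q c) {B B' : List L → K}
    (w : List L) (h : ∀ w', w' ≠ [] → wordParity q w' = wordParity q w + α → B w' = B' w') :
    insertSum q α A c B w = insertSum q α A c B' w := by
  refine splitSum_congr _ fun u w' hw => splitSum_congr _ fun m v hw' => ?_
  by_cases hm : A m = 0
  · simp [hm]
  · rw [h _ (by simp)]
    subst hw hw'
    simp only [wordParity_append, wordParity_cons, hα m hm]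
    linear_combination -CharTwo.add_self_eq_zero α

theorem insertSum_add (B B' : List L → K) (w : List L) :
    insertSum q α A c (fun w => B w + B' w) w
      = insertSum q α A c B w + insertSum q α A c B' w := by
  simp [insertSum, mul_add, splitSum_add]

theorem insertSum_mul (t : K) (B : List L → K) (w : List L) :
    insertSum q α A c (fun w => t * B w) w = t * insertSum q α A c B w := by
  simp only [insertSum, ← splitSum_mul]
  refine splitSum_congr _ fun u w' hw => splitSum_congr _ fun m v hw' => ?_
  ring

/-- After deconcatenating, `A` is applied to shuffles of a prefix of `X` with a prefix of `Y`. These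
die when both prefixes are nonempty (`hA`) or both empty (`hA0`), so the block comes wholly from `X`
or wholly from `Y`. -/
theorem shuffleSum_splitSum_mul (hA : VanishesOnShuffleSums q A) (hA0 : A [] = 0)
    (B : List L → K) (X Y : List L) :
    shuffleSum q X Y (fun w => splitSum w fun m v => A m * B v)
      = splitSum X (fun m v => A m * shuffleSum q v Y B) +
        splitSum Y (fun m v => sgn K (wordParity q X * wordParity q m) *
          (A m * shuffleSum q X v B)) := by
  rw [shuffleSum_splitSum]
  have key : ∀ X₁ X₂ Y₁ Y₂ : List L,
      sgn K (wordParity q X₂ * wordParity q Y₁) *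
        shuffleSum q X₁ Y₁ (fun u => shuffleSum q X₂ Y₂ fun v => A u * B v)
      = sgn K (wordParity q X₂ * wordParity q Y₁) *
        (shuffleSum q X₁ Y₁ A * shuffleSum q X₂ Y₂ B) := by
    intro X₁ X₂ Y₁ Y₂
    simp only [shuffleSum_mul]
    simp only [mul_comm (A _), shuffleSum_mul]
    rw [mul_comm (shuffleSum q X₁ Y₁ A)]
  simp only [key]
  have key2 : ∀ X₁ X₂ : List L, X₁ ≠ [] → (splitSum Y fun Y₁ Y₂ =>
      sgn K (wordParity q X₂ * wordParity q Y₁) *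
        (shuffleSum q X₁ Y₁ A * shuffleSum q X₂ Y₂ B)) = A X₁ * shuffleSum q X₂ Y B := by
    intro X₁ X₂ h
    rw [splitSum_eq_head]
    · simp
    · intro u v hu
      rw [hA _ _ h hu]
      simp
  cases X with
  | nil => simp [hA0]
  | cons a X =>
    simp only [splitSum_cons a X, hA0]
    rw [splitSum_congr X fun u v _ => key2 (a :: u) v (by simp)]
    simp [add_comm]

/-- Insertion of a map vanishing on shuffles is a derivation with respect to shuffle products. -/
theorem shuffleSum_insertSum (hA : VanishesOnShuffleSums q A) (hA0 : A [] = 0)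
    (hα : ∀ m, A m ≠ 0 → wordParity q m = α + q c) (X Y : List L) (B : List L → K) :
    shuffleSum q X Y (insertSum q α A c B)
      = insertSum q α A c (fun w => shuffleSum q w Y B) X +
        sgn K (α * wordParity q X) * insertSum q α A c (fun w => shuffleSum q X w B) Y := by
  induction X generalizing Y B with
  | nil => simp [insertSum_nil hA0]
  | cons a X ihX =>
    induction Y generalizing B with
    | nil => simp [insertSum_nil hA0]
    | cons b Y ihY =>
      -- These are the terms whose block starts at the front of the shuffled word; in all others the
      -- first letter `a` or `b` stays in place and induction applies.
      have hP := shuffleSum_splitSum_mul hA hA0 (fun w => B (c :: w)) (a :: X) (b :: Y)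
      rw [shuffleSum_cons_cons] at hP ⊢
      simp only [insertSum_cons B, shuffleSum_add, shuffleSum_mul]
      rw [ihX, ihY]
      have h1 : insertSum q α A c (fun w => shuffleSum q (a :: w) (b :: Y) B) X
          = insertSum q α A c (fun w => shuffleSum q w (b :: Y) fun w => B (a :: w)) X +
            sgn K (q b * (q a + wordParity q X + α)) *
              insertSum q α A c (fun w => shuffleSum q (a :: w) Y fun w => B (b :: w)) X := by
        rw [← insertSum_mul, ← insertSum_add]
        refine insertSum_congr hα _ fun w _ hw => ?_
        rw [shuffleSum_cons_cons, hw, add_assoc]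
      have h2 := insertSum_cons (q := q) (α := α) (A := A) (c := c)
        (fun w => shuffleSum q w (b :: Y) B) a X
      have h3 := insertSum_cons (q := q) (α := α) (A := A) (c := c)
        (fun w => shuffleSum q w Y fun w => B (b :: w)) a X
      have h4 : splitSum (a :: X) (fun m v => A m * shuffleSum q (c :: v) (b :: Y) B)
          = splitSum (a :: X) (fun m v => A m * shuffleSum q v (b :: Y) fun w => B (c :: w)) +
            sgn K (q b * (q a + wordParity q X + α)) *
              splitSum (a :: X) (fun m v => A m * shuffleSum q (c :: v) Y fun w => B (b :: w)) := by
        rw [← splitSum_mul, ← splitSum_add]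
        refine splitSum_congr _ fun m v h => ?_
        -- Where `A m ≠ 0`, trading `m` for `c` changes the parity by `α`, so the sign of moving `b`
        -- past `c :: v` does not depend on the cut.
        by_cases hm : A m = 0
        · simp [hm]
        have : q a + wordParity q X + α = q c + wordParity q v := by
          rw [← wordParity_cons, ← h, wordParity_append, hα m hm]
          linear_combination CharTwo.add_self_eq_zero α
        rw [shuffleSum_cons_cons, this]
        ring
      have h5 : insertSum q α A c (fun w => shuffleSum q (a :: X) (b :: w) B) Y
          = insertSum q α A c (fun w => shuffleSum q X (b :: w) fun w => B (a :: w)) Y +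
            sgn K (q b * (q a + wordParity q X)) *
              insertSum q α A c (fun w => shuffleSum q (a :: X) w fun w => B (b :: w)) Y := by
        rw [← insertSum_mul, ← insertSum_add]
        simp only [shuffleSum_cons_cons]
      have h6 := insertSum_cons (q := q) (α := α) (A := A) (c := c)
        (fun w => shuffleSum q (a :: X) w B) b Y
      have h7 := insertSum_cons (q := q) (α := α) (A := A) (c := c)
        (fun w => shuffleSum q X w fun w => B (a :: w)) b Y
      have h8 : splitSum (b :: Y) (fun m v => A m * shuffleSum q (a :: X) (c :: v) B)
          = splitSum (b :: Y) (fun m v => A m * shuffleSum q X (c :: v) fun w => B (a :: w)) +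
            sgn K (q c * (q a + wordParity q X)) *
              splitSum (b :: Y) (fun m v => A m * shuffleSum q (a :: X) v fun w => B (c :: w)) := by
        rw [← splitSum_mul, ← splitSum_add]
        refine splitSum_congr _ fun m v h => ?_
        rw [shuffleSum_cons_cons]
        ring
      have h9 : splitSum (b :: Y) (fun m v => sgn K (wordParity q (a :: X) * wordParity q m) *
            (A m * shuffleSum q (a :: X) v fun w => B (c :: w)))
          = sgn K (wordParity q (a :: X) * (α + q c)) * splitSum (b :: Y) (fun m v =>
            A m * shuffleSum q (a :: X) v fun w => B (c :: w)) := by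
        rw [← splitSum_mul]
        refine splitSum_congr _ fun m v h => ?_
        by_cases hm : A m = 0
        · simp [hm]
        · rw [hα m hm]
      rw [h9] at hP
      rw [h1, h4] at h2
      rw [h5, h8] at h6
      rw [h2, h6]
      simp only [wordParity_cons, mul_add, add_mul, sgn_add] at hP h3 h7 ⊢
      rw [mul_comm (q b) α, mul_comm (q c) (q a), mul_comm (q c) (wordParity q X)]
      rw [mul_comm (q a) α, mul_comm (wordParity q X) α] at hP
      linear_combination hP + sgn K (q b * q a) * sgn K (q b * wordParity q X) * sgn K (α * q b) * h3 +
        sgn K (α * q a) * sgn K (α * wordParity q X) * h7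

theorem shuffleSum_singleton (w : List L) (B : List L → K) :
    shuffleSum q [c] w B = splitSum w fun u v => sgn K (q c * wordParity q u) * B (u ++ c :: v) := by
  induction w generalizing B with
  | nil => simp
  | cons b w ih =>
    rw [shuffleSum_cons_cons, ih, splitSum_cons]
    simp only [shuffleSum_nil_left, wordParity_nil, wordParity_cons, mul_add, sgn_add, mul_zero,
      sgn_zero, add_zero, one_mul, ← splitSum_mul, List.nil_append, List.cons_append, mul_assoc,
      mul_comm (q b)]

/-- Only empty blocks count, so `c` is inserted at every place, and `hα` at the empty word forces `α
= q c`, the sign of the shuffle with `[c]`. -/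
theorem insertSum_of_support_nil (hA0 : ∀ m, m ≠ [] → A m = 0)
    (hα : ∀ m, A m ≠ 0 → wordParity q m = α + q c) (B : List L → K) (w : List L) :
    insertSum q α A c B w = A [] * shuffleSum q [c] w B := by
  by_cases h : A [] = 0
  · have : ∀ m, A m = 0 := fun m => by
      by_cases hm : m = []
      · rw [hm, h]
      · exact hA0 m hm
    simp only [insertSum, this, zero_mul, mul_zero]
    exact splitSum_eq_zero _ fun _ _ _ => splitSum_eq_zero _ fun _ _ _ => rfl
  · have hc : α = q c := by
      have := hα [] h
      rw [wordParity_nil] at this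
      exact (CharTwo.add_eq_zero.1 this.symm)
    rw [shuffleSum_singleton, ← splitSum_mul]
    refine splitSum_congr _ fun u w' _ => ?_
    rw [splitSum_eq_head _ fun m v hm => by rw [hA0 m hm]; ring, hc]
    ring

/-- Insertion into a map vanishing on shuffles of a map vanishing on shuffles again gives a map
vanishing on shuffles. -/
theorem VanishesOnShuffleSums.insertSum (hA : VanishesOnShuffleSums q A)
    (hA0 : A [] = 0 ∨ ∀ m, m ≠ [] → A m = 0)
    (hα : ∀ m, A m ≠ 0 → wordParity q m = α + q c)
    {B : List L → K} (hB : VanishesOnShuffleSums q B) :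
    VanishesOnShuffleSums q (insertSum q α A c B) := by
  intro X Y hX hY
  rcases hA0 with hA0 | hA0
  · rw [shuffleSum_insertSum hA hA0 hα,
      insertSum_congr (B' := fun _ => 0) hα X fun w hw _ => hB w Y hw hY,
      insertSum_congr (B' := fun _ => 0) hα Y fun w hw _ => hB X w hX hw]
    have h0 : ∀ w, CyclicForms.insertSum q α A c (fun _ => (0 : K)) w = 0 := fun w => by
      simpa using insertSum_mul (q := q) (α := α) (A := A) (c := c) 0 (fun _ => 0) w
    simp [h0]
  -- Here already each summand vanishes: it is a multiple of the shuffle of `[c]` with the nonempty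
  -- word `w`.
  · refine shuffleSum_eq_zero q X Y fun w hw => ?_
    rw [insertSum_of_support_nil hA0 hα, hB [c] w (by simp), mul_zero]
    rintro rfl
    simp_all

end Words

/-! ### From sums over shuffle permutations to recursive shuffle sums. -/

section Labels

variable {K : Type*} [Field K] {n : ℕ}

/-- The Koszul sign of sorting a word of labels. -/
def inversionSign (K : Type*) [Field K] (q : Fin n → ZMod 2) : List (Fin n) → K
  | [] => 1
  | a :: w => (w.map fun b => if b < a then sgn K (q a * q b) else 1).prod * inversionSign K q w

theorem inversionSign_ofFn (q : Fin n → ZMod 2) {m : ℕ} (f : Fin m → Fin n) :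
    inversionSign K q (List.ofFn f)
      = ∏ a, ∏ b, if a < b ∧ f b < f a then sgn K (q (f a) * q (f b)) else 1 := by
  induction m with
  | zero => simp [inversionSign]
  | succ m ih =>
    simp [List.ofFn_succ, inversionSign, ih, Fin.prod_univ_succ, List.map_ofFn, List.prod_ofFn]

theorem koszulSign_eq_inversionSign (q : Fin n → ZMod 2) (σ : Equiv.Perm (Fin n)) :
    koszulSign K q σ = inversionSign K q (List.ofFn σ.symm) := by
  rw [inversionSign_ofFn, koszulSign, Finset.prod_comm]
  refine Fintype.prod_equiv σ _ _ fun i => Fintype.prod_equiv σ _ _ fun j => ?_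
  simp only [Equiv.symm_apply_apply, and_comm, mul_comm]

theorem inversionSign_of_pairwise (q : Fin n → ZMod 2) {w : List (Fin n)} (h : w.Pairwise (· < ·)) :
    inversionSign K q w = 1 := by
  induction w with
  | nil => rfl
  | cons a w ih =>
    rw [List.pairwise_cons] at h
    rw [inversionSign, ih h.2, mul_one]
    refine List.prod_eq_one fun x hx => ?_
    obtain ⟨b, hb, rfl⟩ := List.mem_map.1 hx
    exact if_neg (h.1 b hb).not_gt

theorem prod_map_sgn (q : Fin n → ZMod 2) (t : ZMod 2) (w : List (Fin n)) :
    (w.map fun b => sgn K (t * q b)).prod = sgn K (t * wordParity q w) := by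
  induction w with
  | nil => simp
  | cons a w ih => simp [ih, mul_add, sgn_add]

theorem inversionSign_cons_of_lt (q : Fin n → ZMod 2) {a : Fin n} {w : List (Fin n)}
    (h : ∀ b ∈ w, a < b) : inversionSign K q (a :: w) = inversionSign K q w := by
  rw [inversionSign, List.prod_eq_one, one_mul]
  intro x hx
  obtain ⟨b, hb, rfl⟩ := List.mem_map.1 hx
  exact if_neg (h b hb).not_gt

/-- The sign that `b` acquires by standing before `w`: exactly the letters of `X` are smaller. It is
the factor in the recursion of `shuffleSum`. -/
theorem prod_inversions_of_perm (q : Fin n → ZMod 2) {b : Fin n} {w X Y : List (Fin n)}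
    (hw : w.Perm (X ++ Y)) (hX : ∀ a ∈ X, a < b) (hY : ∀ a ∈ Y, b < a) :
    (w.map fun a => if a < b then sgn K (q b * q a) else 1).prod
      = sgn K (q b * wordParity q X) := by
  rw [(hw.map _).prod_eq, List.map_append, List.prod_append, ← prod_map_sgn,
    List.map_congr_left fun a ha => if_pos (hX a ha),
    List.map_congr_left fun a ha => if_neg (hY a ha).not_gt]
  simp

/-- The inversions are exactly the pairs from `v` and `u`; this gives the sign of a rotation. -/
theorem inversionSign_append_of_lt (q : Fin n → ZMod 2) {u v : List (Fin n)}
    (hv : v.Pairwise (· < ·)) (hu : u.Pairwise (· < ·)) (huv : ∀ a ∈ u, ∀ b ∈ v, a < b) :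
    inversionSign K q (v ++ u) = sgn K (wordParity q u * wordParity q v) := by
  induction v with
  | nil => simp [inversionSign_of_pairwise q hu]
  | cons b v ih =>
    rw [List.pairwise_cons] at hv
    rw [List.cons_append, inversionSign,
      prod_inversions_of_perm q (X := u) (Y := v) List.perm_append_comm
        (fun a ha => huv a ha b (by simp)) hv.1,
      ih hv.2 fun a ha c hc => huv a ha c (by simp [hc]), ← sgn_add, wordParity_cons]
    congr 1
    ring

/-- Twisting by the sign of sorting turns signed into unsigned shuffle sums. -/
theorem shuffleSum_labels {L : Type*} (q : L → ZMod 2) (x : Fin n → L) (X Y : List (Fin n))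
    (hX : X.Pairwise (· < ·)) (hY : Y.Pairwise (· < ·)) (hXY : ∀ a ∈ X, ∀ b ∈ Y, a < b)
    (f : List L → K) :
    shuffleSum (fun _ => 0) X Y (fun w => inversionSign K (fun i => q (x i)) w * f (w.map x))
      = shuffleSum q (X.map x) (Y.map x) f := by
  induction X generalizing Y f with
  | nil => simp [inversionSign_of_pairwise _ hY]
  | cons a X ihX =>
    induction Y generalizing f with
    | nil => simp [inversionSign_of_pairwise _ hX]
    | cons b Y ihY =>
      have hX' := List.pairwise_cons.1 hX
      have hY' := List.pairwise_cons.1 hY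
      have hp : q (x a) + wordParity q (X.map x) = wordParity (fun i => q (x i)) (a :: X) := by
        simp [wordParity, Function.comp_def]
      rw [List.map_cons, List.map_cons, shuffleSum_cons_cons, shuffleSum_cons_cons,
        ← List.map_cons, ← List.map_cons,
        ← ihX (b :: Y) hX'.2 hY (fun c hc => hXY c (by simp [hc])),
        ← ihY hY'.2 (fun c hc d hd => hXY c hc d (by simp [hd])), hp, zero_mul,
        sgn_zero, one_mul, ← shuffleSum_mul]
      congr 1
      · refine shuffleSum_congr _ _ _ fun w hw => ?_
        rw [inversionSign_cons_of_lt (K := K) _ fun c hc => ?_, List.map_cons]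
        rcases List.mem_append.1 (hw.subset hc) with h | h
        · exact hX'.1 c h
        · exact hXY a (by simp) c h
      · refine shuffleSum_congr _ _ _ fun w hw => ?_
        rw [inversionSign, prod_inversions_of_perm (K := K) (fun i => q (x i)) hw
            (fun c hc => hXY c hc b (by simp)) hY'.1,
          List.map_cons, mul_assoc]

/-- The list of all shuffles of two words. -/
def shuffleWords {L : Type*} : List L → List L → List (List L)
  | [], Y => [Y]
  | a :: X, [] => [a :: X]
  | a :: X, b :: Y =>
      (shuffleWords X (b :: Y)).map (a :: ·) ++ (shuffleWords (a :: X) Y).map (b :: ·)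
termination_by X Y => X.length + Y.length

theorem sum_shuffleWords {L : Type*} (X Y : List L) (f : List L → K) :
    ((shuffleWords X Y).map f).sum = shuffleSum (fun _ => 0) X Y f := by
  induction X, Y, f using shuffleSum.induct with
  | case1 => simp [shuffleWords]
  | case2 => simp [shuffleWords]
  | case3 a X b Y f ih1 ih2 =>
    rw [shuffleSum_cons_cons, shuffleWords, ← ih1, ← ih2]
    simp [Function.comp_def]

/-- With distinct letters, the first letter of `w` must be the head of `X` or of `Y`: otherwise `X`
and `Y` both embed in the tail, which would then repeat that letter. -/
theorem mem_shuffleWords {L : Type*} {X Y : List L} (h : (X ++ Y).Nodup) {w : List L} :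
    w ∈ shuffleWords X Y ↔ w.Perm (X ++ Y) ∧ X.Sublist w ∧ Y.Sublist w := by
  induction X, Y using shuffleWords.induct generalizing w with
  | case1 Y =>
    simp only [shuffleWords, List.mem_singleton, List.nil_append, List.nil_sublist, true_and]
    constructor
    · rintro rfl; simp
    · rintro ⟨h1, h2⟩; exact (h2.eq_of_length h1.length_eq.symm).symm
  | case2 a X =>
    simp only [shuffleWords, List.mem_singleton, List.append_nil, List.nil_sublist, and_true]
    constructor
    · rintro rfl; simp
    · rintro ⟨h1, h2⟩; exact (h2.eq_of_length h1.length_eq.symm).symm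
  | case3 a X b Y ih1 ih2 =>
    have hab : a ≠ b := by
      rintro rfl
      simp at h
    have h1 : (X ++ b :: Y).Nodup := (List.nodup_cons.1 h).2
    have h2 : (a :: X ++ Y).Nodup := (List.nodup_cons.1 (List.perm_middle.nodup_iff.1 h)).2
    simp only [shuffleWords, List.mem_append, List.mem_map, ih1 h1, ih2 h2]
    constructor
    · rintro (⟨w, ⟨hw, hX, hY⟩, rfl⟩ | ⟨w, ⟨hw, hX, hY⟩, rfl⟩)
      · exact ⟨hw.cons a, hX.cons_cons a, hY.cons a⟩
      · exact ⟨(hw.cons b).trans List.perm_middle.symm, hX.cons b, hY.cons_cons b⟩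
    · rintro ⟨hw, hX, hY⟩
      cases w with
      | nil => simp at hX
      | cons c w =>
        have hn := List.nodup_cons.1 (hw.nodup_iff.2 h)
        by_cases hca : c = a
        · subst hca
          refine Or.inl ⟨w, ⟨(List.perm_cons _).1 hw, List.cons_sublist_cons.1 hX, ?_⟩, rfl⟩
          exact (List.sublist_cons_iff.1 hY).resolve_right fun ⟨r, hr, _⟩ => hab (by simp_all)
        by_cases hcb : c = b
        · subst hcb
          refine Or.inr ⟨w, ⟨(List.perm_cons _).1 (hw.trans List.perm_middle), ?_,
            List.cons_sublist_cons.1 hY⟩, rfl⟩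
          exact (List.sublist_cons_iff.1 hX).resolve_right fun ⟨r, hr, _⟩ => hca (by simp_all)
        have hX' := (List.sublist_cons_iff.1 hX).resolve_right fun ⟨r, hr, _⟩ => hca (by simp_all)
        have hY' := (List.sublist_cons_iff.1 hY).resolve_right fun ⟨r, hr, _⟩ => hcb (by simp_all)
        have hc : c ∈ a :: X ++ b :: Y := hw.subset (by simp)
        rcases List.mem_append.1 hc with hc | hc
        · exact absurd (hX'.subset hc) hn.1
        · exact absurd (hY'.subset hc) hn.1

theorem nodup_shuffleWords {L : Type*} {X Y : List L} (h : (X ++ Y).Nodup) :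
    (shuffleWords X Y).Nodup := by
  induction X, Y using shuffleWords.induct with
  | case1 Y => simp [shuffleWords]
  | case2 a X => simp [shuffleWords]
  | case3 a X b Y ih1 ih2 =>
    have hab : a ≠ b := by
      rintro rfl
      simp at h
    have h1 : (X ++ b :: Y).Nodup := (List.nodup_cons.1 h).2
    have h2 : (a :: X ++ Y).Nodup := (List.nodup_cons.1 (List.perm_middle.nodup_iff.1 h)).2
    rw [shuffleWords]
    refine List.Nodup.append ((ih1 h1).map (List.cons_injective))
      ((ih2 h2).map (List.cons_injective)) ?_
    intro w hw hw'
    obtain ⟨u, _, rfl⟩ := List.mem_map.1 hw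
    obtain ⟨v, _, hv⟩ := List.mem_map.1 hw'
    exact hab (List.cons.inj hv).1.symm

theorem ofFn_perm_finRange (σ : Equiv.Perm (Fin n)) : (List.ofFn σ).Perm (List.finRange n) := by
  refine (List.perm_ext_iff_of_nodup (List.nodup_ofFn.2 σ.injective) (List.nodup_finRange n)).2 ?_
  intro a
  simp [List.mem_ofFn, σ.surjective a]

/-- The word of `σ.symm` lists the letters by their places under `σ`. Hence `σ` is increasing on a
block exactly when that block, in order, is a sublist of the word. -/
theorem mem_shuffles_iff (p : ℕ) (σ : Equiv.Perm (Fin n)) :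
    σ ∈ shuffles n p ↔ List.ofFn σ.symm ∈
      shuffleWords ((List.finRange n).take p) ((List.finRange n).drop p) := by
  have hpos : (List.ofFn σ.symm).Pairwise (fun a b => σ a < σ b) := by
    rw [List.pairwise_ofFn]
    intro i j hij
    simpa using hij
  have hsort : (List.finRange n).Pairwise (· < ·) := List.pairwise_lt_finRange n
  have hperm := ofFn_perm_finRange σ.symm
  have hnd := hperm.nodup_iff.2 (List.nodup_finRange n)
  have htake : ∀ a : Fin n, a ∈ (List.finRange n).take p ↔ (a : ℕ) < p := by
    intro a
    rw [List.mem_take_iff_getElem]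
    constructor
    · rintro ⟨i, hi, rfl⟩
      simp at hi ⊢
      omega
    · intro h
      exact ⟨a, by simp [h], by simp⟩
  have hdrop : ∀ a : Fin n, a ∈ (List.finRange n).drop p ↔ p ≤ (a : ℕ) := by
    intro a
    rw [List.mem_drop_iff_getElem]
    constructor
    · rintro ⟨i, hi, rfl⟩
      simp
    · intro h
      exact ⟨a - p, by simp; omega, by ext; simp; omega⟩
  rw [mem_shuffleWords (by simpa using List.nodup_finRange n), List.take_append_drop]
  simp only [shuffles, Finset.mem_filter, Finset.mem_univ, true_and, hperm]
  have key : ∀ (P : Fin n → Prop) [DecidablePred P] (X : List (Fin n)), X.Pairwise (· < ·) →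
      (∀ a, a ∈ X ↔ P a) →
      ((∀ i j, i < j → P i → P j → σ i < σ j) ↔ X.Sublist (List.ofFn σ.symm)) := by
    intro P _ X hX hP
    constructor
    · intro h
      -- Both lists are increasing and have the same members.
      have : (List.ofFn σ.symm).filter P = X := by
        refine List.Perm.eq_of_pairwise (le := (· < ·)) ?_ ?_ hX ?_
        · intro a b _ _ hab hba
          exact absurd hab hba.not_gt
        · refine (hpos.filter _).imp_of_mem ?_
          intro a b ha hb hab
          simp only [List.mem_filter, decide_eq_true_eq] at ha hb
          rcases lt_trichotomy a b with h' | h' | h'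
          · exact h'
          · exact absurd hab (by simp [h'])
          · exact absurd hab (h b a h' hb.2 ha.2).not_gt
        · refine (List.perm_ext_iff_of_nodup (hnd.filter _) (hX.imp ne_of_lt)).2 fun a => ?_
          simp only [List.mem_filter, decide_eq_true_eq, hP]
          exact ⟨fun h => h.2, fun h => ⟨hperm.symm.subset (List.mem_finRange a), h⟩⟩
      rw [← this]
      exact List.filter_sublist
    · intro h i j hij hi hj
      obtain ⟨a, ha, rfl⟩ := List.getElem_of_mem ((hP i).2 hi)
      obtain ⟨b, hb, rfl⟩ := List.getElem_of_mem ((hP j).2 hj)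
      refine List.pairwise_iff_getElem.1 (hpos.sublist h) a b ha hb ?_
      by_contra hab
      rcases (not_lt.1 hab).lt_or_eq with h' | rfl
      · exact absurd hij (List.pairwise_iff_getElem.1 hX b a hb ha h').not_gt
      · exact absurd hij (lt_irrefl _)
  rw [← key (fun a => (a : ℕ) < p) _ (hsort.sublist (List.take_sublist _ _)) htake,
    ← key (fun a => p ≤ (a : ℕ)) _ (hsort.sublist (List.drop_sublist _ _)) hdrop]
  constructor
  · rintro ⟨h1, h2⟩
    exact ⟨fun i j hij _ hj => h1 i j hij hj, fun i j hij hi _ => h2 i j hij hi⟩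
  · rintro ⟨h1, h2⟩
    exact ⟨fun i j hij hj => h1 i j hij (lt_trans hij hj) hj,
      fun i j hij hi => h2 i j hij hi (hi.trans hij.le)⟩

theorem sum_shuffles (p : ℕ) (G : List (Fin n) → K) :
    ∑ σ ∈ shuffles n p, G (List.ofFn σ.symm)
      = shuffleSum (fun _ => 0) ((List.finRange n).take p) ((List.finRange n).drop p) G := by
  have hnd : ((List.finRange n).take p ++ (List.finRange n).drop p).Nodup := by
    simpa using List.nodup_finRange n
  rw [← sum_shuffleWords, ← List.sum_toFinset _ (nodup_shuffleWords hnd)]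
  refine Finset.sum_nbij (fun σ => List.ofFn σ.symm) ?_ ?_ ?_ fun _ _ => rfl
  · intro σ hσ
    simpa using (mem_shuffles_iff p σ).1 hσ
  · intro σ _ τ _ h
    have := List.ofFn_injective h
    exact Equiv.symm_bijective.injective (DFunLike.coe_injective this)
  · intro w hw
    have hw' : w ∈ shuffleWords ((List.finRange n).take p) ((List.finRange n).drop p) := by
      simpa using hw
    have hperm := ((mem_shuffleWords hnd).1 hw').1
    rw [List.take_append_drop] at hperm
    have hlen : w.length = n := by simpa using hperm.length_eq
    obtain ⟨g, rfl⟩ : ∃ g : Fin n → Fin n, w = List.ofFn g :=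
      ⟨fun i => w.get (i.cast hlen.symm), List.ext_get (by simp [hlen]) (by simp)⟩
    have hinj : Function.Injective g :=
      List.nodup_ofFn.1 (hperm.nodup_iff.2 (List.nodup_finRange _))
    let τ : Equiv.Perm (Fin n) := Equiv.ofBijective g (Finite.injective_iff_bijective.1 hinj)
    exact ⟨τ.symm, (mem_shuffles_iff p τ.symm).2 hw', rfl⟩

end Labels

/-! ### The cyclic group as rotations of a word. -/

section Rotation

theorem finRotate_pow_val {m : ℕ} (j : ℕ) (i : Fin (m + 1)) :
    ((finRotate (m + 1) ^ j) i : ℕ) = (i + j) % (m + 1) := by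
  induction j with
  | zero => simp [Nat.mod_eq_of_lt i.2]
  | succ j ih =>
    rw [pow_succ', Equiv.Perm.mul_apply, finRotate_apply, Fin.val_add, ih, ← add_assoc,
      Nat.add_mod (i + j : ℕ) 1]
    simp

theorem finRotate_pow_self (m : ℕ) : finRotate (m + 1) ^ (m + 1) = 1 := by
  ext i
  simp [finRotate_pow_val, Nat.mod_eq_of_lt i.2]

theorem ofFn_finRotate_pow {m j : ℕ} (hj : j ≤ m + 1) :
    List.ofFn (finRotate (m + 1) ^ j)
      = (List.finRange (m + 1)).drop j ++ (List.finRange (m + 1)).take j := by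
  rw [← List.rotate_eq_drop_append_take (by simpa using hj)]
  refine List.ext_getElem (by simp) fun i h1 h2 => ?_
  ext
  rw [List.getElem_ofFn, finRotate_pow_val]
  simp [List.getElem_rotate]

open Classical in
-- The group is parametrised by the inverse powers with `j < m + 1`, so that the word of `τ.symm` is
-- the rotation by `j`; the image of `0` recovers `j`.
theorem sum_zpowers_finRotate {M : Type*} [AddCommMonoid M] {m : ℕ}
    (G : List (Fin (m + 1)) → M) :
    ∑ τ : Equiv.Perm (Fin (m + 1)) with τ ∈ Subgroup.zpowers (finRotate (m + 1)),
        G (List.ofFn τ.symm)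
      = ∑ j ∈ Finset.range (m + 1),
        G ((List.finRange (m + 1)).drop j ++ (List.finRange (m + 1)).take j) := by
  symm
  refine Finset.sum_nbij (fun j => (finRotate (m + 1) ^ j)⁻¹) ?_ ?_ ?_ ?_
  · intro j _
    simp only [Finset.mem_filter, Finset.mem_univ, true_and]
    exact inv_mem (Subgroup.npow_mem_zpowers _ _)
  · intro i hi j hj h
    have h' : finRotate (m + 1) ^ i = finRotate (m + 1) ^ j := inv_injective h
    have h0 := congrArg (fun σ : Equiv.Perm (Fin (m + 1)) => ((σ 0 : Fin (m + 1)) : ℕ)) h'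
    simp only [finRotate_pow_val] at h0
    simp only [Finset.coe_range, Set.mem_Iio] at hi hj
    simpa [Nat.mod_eq_of_lt hi, Nat.mod_eq_of_lt hj] using h0
  · intro τ hτ
    simp only [Finset.coe_filter, Finset.mem_univ, true_and, Set.mem_ofPred_eq] at hτ
    obtain ⟨z, hz⟩ := Subgroup.mem_zpowers_iff.1 (inv_mem hτ)
    have h0 : (0 : ℤ) ≤ z % ((m + 1 : ℕ) : ℤ) := Int.emod_nonneg _ (by omega)
    have h1 : z % ((m + 1 : ℕ) : ℤ) < ((m + 1 : ℕ) : ℤ) := Int.emod_lt_of_pos _ (by omega)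
    refine ⟨(z % ((m + 1 : ℕ) : ℤ)).toNat, ?_, ?_⟩
    · simp only [Finset.coe_range, Set.mem_Iio]
      omega
    · show (finRotate (m + 1) ^ (z % ((m + 1 : ℕ) : ℤ)).toNat)⁻¹ = τ
      rw [inv_eq_iff_eq_inv, ← hz, ← zpow_natCast, Int.toNat_of_nonneg h0]
      refine (zpow_eq_zpow_emod _ ?_).symm
      rw [zpow_natCast, finRotate_pow_self]
  · intro j hj
    rw [← ofFn_finRotate_pow (Finset.mem_range.1 hj).le]
    rfl

end Rotation

/-! ### Forms as functions on words of homogeneous vectors. -/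

section Evaluation

variable {K V : Type*} [Field K] [AddCommGroup V] [Module K V]
  (𝒱 : ℤ → Submodule K V)

/-- Homogeneous vectors. -/
abbrev Letter : Type _ := Σ d : ℤ, 𝒱 d

/-- The shifted parity of a homogeneous vector. -/
def letterParity (a : Letter 𝒱) : ZMod 2 := parity a.1

/-- The underlying vector of a homogeneous vector. -/
def letterVec (a : Letter 𝒱) : V := a.2

variable {𝒱}

theorem letterVec_mem (a : Letter 𝒱) : letterVec 𝒱 a ∈ 𝒱 a.1 := a.2.2

/-- The value of an `n`-linear form at a word of homogeneous vectors; it is `0` unless the word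
has length `n`. -/
def evalWord {n : ℕ} (F : Form K V n) (w : List (Letter 𝒱)) : K :=
  if h : w.length = n then F (fun i => letterVec 𝒱 (w.get (i.cast h.symm))) else 0

theorem evalWord_ofFn {n : ℕ} (F : Form K V n) (x : Fin n → Letter 𝒱) :
    evalWord F (List.ofFn x) = F (fun i => letterVec 𝒱 (x i)) := by
  rw [evalWord, dif_pos (by simp)]
  congr 1
  funext i
  simp

theorem evalWord_of_length_ne {n : ℕ} (F : Form K V n) {w : List (Letter 𝒱)}
    (h : w.length ≠ n) : evalWord F w = 0 := dif_neg h

theorem exists_eq_ofFn {α : Type*} {n : ℕ} {w : List α} (h : w.length = n) :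
    ∃ x : Fin n → α, w = List.ofFn x :=
  ⟨fun i => w.get (i.cast h.symm), List.ext_get (by simp [h]) (by simp)⟩

theorem ofFn_append_singleton {α : Type*} {n : ℕ} (x : Fin n → α) (y : α) :
    List.ofFn x ++ [y] = List.ofFn (Fin.snoc (α := fun _ => α) x y) := by
  rw [List.ofFn_succ']
  simp

theorem evalWord_append_singleton {n : ℕ} (F : Form K V (n + 1)) (x : Fin n → Letter 𝒱)
    (y : Letter 𝒱) :
    evalWord F (List.ofFn x ++ [y])
      = F (Fin.snoc (α := fun _ => V) (fun i => letterVec 𝒱 (x i)) (letterVec 𝒱 y)) := by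
  rw [ofFn_append_singleton, evalWord_ofFn]
  congr 1
  funext i
  refine Fin.lastCases ?_ (fun i => ?_) i <;> simp

theorem evalWord_cons {n : ℕ} (F : Form K V (n + 1)) (x : Fin n → Letter 𝒱)
    (y : Letter 𝒱) :
    evalWord F (y :: List.ofFn x)
      = F (Fin.cons (α := fun _ => V) (letterVec 𝒱 y) (fun i => letterVec 𝒱 (x i))) := by
  have : y :: List.ofFn x = List.ofFn (Fin.cons (α := fun _ => Letter 𝒱) y x) := by simp
  rw [this, evalWord_ofFn]
  congr 1
  funext i
  refine Fin.cases ?_ (fun i => ?_) i <;> simp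

theorem koszulSign_finRotate {m : ℕ} (q : Fin (m + 1) → ZMod 2) :
    koszulSign K q (finRotate (m + 1))
      = sgn K (wordParity q (List.ofFn (Fin.castSucc : Fin m → _)) * q (Fin.last m)) := by
  have h : List.ofFn (finRotate (m + 1)).symm = [Fin.last m] ++ List.ofFn Fin.castSucc := by
    rw [List.ofFn_succ]
    have h0 : (finRotate (m + 1)).symm 0 = Fin.last m := by
      rw [Equiv.symm_apply_eq, finRotate_last]
    have h1 : ∀ i : Fin m, (finRotate (m + 1)).symm i.succ = i.castSucc := fun i => by
      rw [Equiv.symm_apply_eq, finRotate_apply, Fin.coeSucc_eq_succ]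
    simp only [h0, h1, List.singleton_append]
  rw [koszulSign_eq_inversionSign, h, inversionSign_append_of_lt]
  · simp
  · simp
  · rw [List.pairwise_ofFn]
    intro i j hij
    exact hij
  · intro a ha b hb
    obtain ⟨i, rfl⟩ := (List.mem_ofFn' _ _).1 ha
    rw [List.mem_singleton.1 hb]
    exact Fin.castSucc_lt_last i

/-- Words of the wrong length may be included because both sides are then `0`; the sign is that of
the last letter passing the others. -/
theorem isCyclic_iff {n : ℕ} (F : Form K V n) :
    IsCyclic 𝒱 F ↔ ∀ (w : List (Letter 𝒱)) (a : Letter 𝒱),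
      evalWord F (w ++ [a])
        = sgn K (wordParity (letterParity 𝒱) w * letterParity 𝒱 a) * evalWord F (a :: w) := by
  cases n with
  | zero =>
    simp only [evalWord_of_length_ne (n := 0) F (w := _ :: _) (by simp),
      evalWord_of_length_ne (n := 0) F (w := _ ++ [_]) (by simp), mul_zero, implies_true, iff_true]
    intro d x _
    rw [koszulSign]
    simp [Subsingleton.elim _ x]
  | succ m =>
    have key : ∀ (x : Fin m → Letter 𝒱) (a : Letter 𝒱),
        koszulSign K (fun i => parity (Fin.snoc (α := fun _ => Letter 𝒱) x a i).1) (finRotate (m + 1)) *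
          F (fun i => letterVec 𝒱 (Fin.snoc (α := fun _ => Letter 𝒱) x a ((finRotate (m + 1)).symm i)))
        = sgn K (wordParity (letterParity 𝒱) (List.ofFn x) * letterParity 𝒱 a) *
          evalWord F (a :: List.ofFn x) := by
      intro x a
      rw [koszulSign_finRotate, evalWord_cons]
      congr 2
      · simp [wordParity, List.map_ofFn, Function.comp_def, letterParity]
      · funext i
        refine Fin.cases ?_ (fun i => ?_) i
        · have h0 : (finRotate (m + 1)).symm 0 = Fin.last m := by
            rw [Equiv.symm_apply_eq, finRotate_last]
          simp [h0]
        · have h1 : (finRotate (m + 1)).symm i.succ = i.castSucc := by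
            rw [Equiv.symm_apply_eq, finRotate_apply, Fin.coeSucc_eq_succ]
          simp [h1]
    constructor
    · intro h w a
      by_cases hw : w.length = m
      · obtain ⟨x, rfl⟩ := exists_eq_ofFn hw
        rw [← key, ofFn_append_singleton, evalWord_ofFn]
        exact (h (fun i => (Fin.snoc (α := fun _ => Letter 𝒱) x a i).1) _ fun i => letterVec_mem _).symm
      · rw [evalWord_of_length_ne _ (by simpa using hw), evalWord_of_length_ne _ (by simpa using hw),
          mul_zero]
    · intro h d x hx
      let z : Fin (m + 1) → Letter 𝒱 := fun i => ⟨d i, x i, hx i⟩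
      have hz : z = Fin.snoc (α := fun _ => Letter 𝒱) (Fin.init z) (z (Fin.last m)) :=
        (Fin.snoc_init_self z).symm
      have h1 := key (Fin.init z) (z (Fin.last m))
      rw [← h, ofFn_append_singleton, evalWord_ofFn, ← hz] at h1
      exact h1

/-- The sum over shuffle permutations as a shuffle sum over words. -/
theorem sum_shuffles_eq_shuffleSum {k : ℕ} (F : Form K V (k + 1)) (p : ℕ)
    (x : Fin k → Letter 𝒱) (y : Letter 𝒱) :
    ∑ σ ∈ shuffles k p, koszulSign K (fun i => parity (x i).1) σ *
        F (Fin.snoc (α := fun _ => V) (fun i => letterVec 𝒱 (x (σ.symm i))) (letterVec 𝒱 y))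
      = shuffleSum (letterParity 𝒱) ((List.ofFn x).take p) ((List.ofFn x).drop p)
          (fun w => evalWord F (w ++ [y])) := by
  have hx : List.ofFn x = (List.finRange k).map x := List.ofFn_eq_map
  rw [hx, ← List.map_take, ← List.map_drop, ← shuffleSum_labels, ← sum_shuffles]
  · refine Finset.sum_congr rfl fun σ _ => ?_
    rw [koszulSign_eq_inversionSign, List.map_ofFn, evalWord_append_singleton]
    rfl
  · exact (List.pairwise_lt_finRange k).sublist (List.take_sublist _ _)
  · exact (List.pairwise_lt_finRange k).sublist (List.drop_sublist _ _)
  · have h := List.pairwise_lt_finRange k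
    rw [← List.take_append_drop p (List.finRange k), List.pairwise_append] at h
    exact h.2.2

/-- A homogeneous last argument suffices by linearity, and `p` becomes the length of the first word.
-/
theorem vanishesOnShuffles_iff [DirectSum.Decomposition 𝒱] {n : ℕ} (F : Form K V n) :
    VanishesOnShuffles 𝒱 F ↔ ∀ y : Letter 𝒱,
      VanishesOnShuffleSums (letterParity 𝒱) (fun w => evalWord F (w ++ [y])) := by
  cases n with
  | zero =>
    simp only [VanishesOnShuffles, true_iff]
    intro y X Y _ _
    exact shuffleSum_eq_zero _ _ _ fun w _ => evalWord_of_length_ne _ (by simp)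
  | succ k =>
    constructor
    · intro h y X Y hX hY
      by_cases hl : (X ++ Y).length = k
      · obtain ⟨x, hx⟩ := exists_eq_ofFn hl
        have hX' := List.length_pos_iff.2 hX
        have hY' := List.length_pos_iff.2 hY
        rw [List.length_append] at hl
        have := sum_shuffles_eq_shuffleSum F X.length x y
        rw [← hx, List.take_left, List.drop_left] at this
        rw [← this]
        exact h _ hX' (by omega) (fun i => (x i).1) _ (fun i => letterVec_mem _) _
      · refine shuffleSum_eq_zero _ _ _ fun w hw => evalWord_of_length_ne _ ?_
        simpa [hw.length_eq] using hl
    · intro h p hp hpk d x hx y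
      induction y using DirectSum.Decomposition.inductionOn 𝒱 with
      | zero =>
        refine Finset.sum_eq_zero fun σ _ => ?_
        rw [F.map_coord_zero (Fin.last k) (by simp), mul_zero]
      | @homogeneous i y =>
        have := sum_shuffles_eq_shuffleSum F p (fun i => (⟨d i, x i, hx i⟩ : Letter 𝒱)) ⟨i, y⟩
        refine this.trans (h _ _ _ ?_ ?_)
        · rw [← List.length_pos_iff]
          simp; omega
        · rw [← List.length_pos_iff]
          simp; omega
      | add y y' h1 h2 =>
        have : ∀ z : Fin k → V, F (Fin.snoc (α := fun _ => V) z (y + y'))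
            = F (Fin.snoc (α := fun _ => V) z y) + F (Fin.snoc (α := fun _ => V) z y') := by
          intro z
          simpa using (F.curryRight z).map_add y y'
        simp only [this, mul_add, Finset.sum_add_distrib, h1, h2, add_zero]

variable [DirectSum.Decomposition 𝒱]

theorem parityProj_of_mem {d : ℤ} {x : V} (hx : x ∈ 𝒱 d) (p : ZMod 2) :
    parityProj 𝒱 p x = if parity d = p then x else 0 := by
  rw [parityProj, LinearMap.comp_apply]
  have : (DirectSum.decomposeLinearEquiv 𝒱).toLinearMap x
      = DirectSum.lof K ℤ (fun i => 𝒱 i) d ⟨x, hx⟩ :=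
    DirectSum.decompose_of_mem 𝒱 hx
  rw [this, DirectSum.toModule_lof]
  split_ifs <;> simp

/-- For any parity vector other than the actual one, some projection kills its argument. -/
theorem signed_apply {n : ℕ} (s : (Fin n → ZMod 2) → K) (F : Form K V n)
    (x : Fin n → Letter 𝒱) :
    signed 𝒱 s F (fun i => letterVec 𝒱 (x i))
      = s (fun i => letterParity 𝒱 (x i)) * F (fun i => letterVec 𝒱 (x i)) := by
  simp only [signed, sum_apply, smul_apply,
    MultilinearMap.compLinearMap_apply, smul_eq_mul]
  rw [Finset.sum_eq_single (fun i => letterParity 𝒱 (x i))]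
  · congr 2
    funext i
    rw [parityProj_of_mem (letterVec_mem (x i))]
    exact if_pos rfl
  · intro q _ hq
    obtain ⟨i, hi⟩ := Function.ne_iff.1 hq
    rw [F.map_coord_zero i, mul_zero]
    rw [parityProj_of_mem (letterVec_mem (x i))]
    exact if_neg (Ne.symm hi)
  · simp

theorem evalWord_cyclicize_eq_sum {m : ℕ} (F : Form K V (m + 1)) {w : List (Letter 𝒱)}
    (hw : w.length = m + 1) :
    evalWord (cyclicize 𝒱 F) w = ∑ j ∈ Finset.range (m + 1),
      sgn K (wordParity (letterParity 𝒱) (w.take j) * wordParity (letterParity 𝒱) (w.drop j)) *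
        evalWord F (w.drop j ++ w.take j) := by
  classical
  obtain ⟨x, rfl⟩ := exists_eq_ofFn hw
  have h1 : evalWord (cyclicize 𝒱 F) (List.ofFn x)
      = ∑ τ : Equiv.Perm (Fin (m + 1)) with τ ∈ Subgroup.zpowers (finRotate (m + 1)),
        inversionSign K (fun i => letterParity 𝒱 (x i)) (List.ofFn τ.symm) *
          evalWord F ((List.ofFn τ.symm).map x) := by
    rw [evalWord_ofFn, cyclicize, sum_apply]
    refine Finset.sum_congr ?_ fun τ _ => ?_
    · congr
    · rw [permAct, signed_apply, koszulSign_eq_inversionSign, List.map_ofFn, evalWord_ofFn]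
      rfl
  rw [h1, sum_zpowers_finRotate (fun w => inversionSign K (fun i => letterParity 𝒱 (x i)) w *
          evalWord F (w.map x))]
  refine Finset.sum_congr rfl fun j _ => ?_
  have hx : List.ofFn x = (List.finRange (m + 1)).map x := List.ofFn_eq_map
  have h := List.pairwise_lt_finRange (m + 1)
  rw [← List.take_append_drop j (List.finRange (m + 1)), List.pairwise_append] at h
  rw [inversionSign_append_of_lt _ h.2.1 h.1 h.2.2, hx, ← List.map_take, ← List.map_drop,
    List.map_append]
  simp [wordParity, Function.comp_def]

theorem evalWord_cyclicize_append {n : ℕ} (F : Form K V n) (X : List (Letter 𝒱)) (y : Letter 𝒱) :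
    evalWord (cyclicize 𝒱 F) (X ++ [y]) = splitSum X fun u v =>
      sgn K (wordParity (letterParity 𝒱) u *
        (wordParity (letterParity 𝒱) v + letterParity 𝒱 y)) * evalWord F (v ++ y :: u) := by
  by_cases h : X.length + 1 = n
  · subst h
    rw [evalWord_cyclicize_eq_sum F (by simp), splitSum]
    refine Finset.sum_congr rfl fun j hj => ?_
    have hj' : j ≤ X.length := by simpa [Nat.lt_succ_iff] using hj
    rw [List.take_append_of_le_length hj', List.drop_append_of_le_length hj']
    simp
  · rw [evalWord_of_length_ne _ (by simpa using h), splitSum_eq_zero]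
    rintro u v rfl
    rw [evalWord_of_length_ne _ (by simp at h ⊢; omega), mul_zero]

theorem evalWord_cyclicize_cons {n : ℕ} (F : Form K V n) (X : List (Letter 𝒱)) (y : Letter 𝒱) :
    evalWord (cyclicize 𝒱 F) (y :: X) = splitSum X fun u v =>
      sgn K ((letterParity 𝒱 y + wordParity (letterParity 𝒱) u) *
        wordParity (letterParity 𝒱) v) * evalWord F (v ++ y :: u) := by
  by_cases h : X.length + 1 = n
  · subst h
    -- The trivial rotation of `y :: X` corresponds to the cut at the end of `X`; the rotation by `j
    -- + 1` corresponds to the cut of `X` at `j`.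
    rw [evalWord_cyclicize_eq_sum F (by simp), splitSum, Finset.sum_range_succ',
      Finset.sum_range_succ]
    simp
  · rw [evalWord_of_length_ne _ (by simpa using h), splitSum_eq_zero]
    rintro u v rfl
    rw [evalWord_of_length_ne _ (by simp at h ⊢; omega), mul_zero]

theorem isCyclic_cyclicize {n : ℕ} (F : Form K V n) : IsCyclic 𝒱 (cyclicize 𝒱 F) := by
  rw [isCyclic_iff]
  intro w a
  rw [evalWord_cyclicize_append, evalWord_cyclicize_cons, ← splitSum_mul]
  refine splitSum_congr _ fun u v h => ?_
  subst h
  rw [← mul_assoc, ← sgn_add, wordParity_append]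
  congr 2
  linear_combination -CharTwo.add_self_eq_zero (wordParity (letterParity 𝒱) v * letterParity 𝒱 a)

/-- Only the cut at `k` contributes, the others having wrong lengths; summing over all cuts removes
`k` and `l` from the formula. -/
theorem evalWord_contractProd {k l : ℕ} (p : ZMod 2) (c c' : Letter 𝒱)
    (A : Form K V (k + 1)) (B : Form K V (l + 1)) (w : List (Letter 𝒱)) :
    evalWord (contractProd 𝒱 p (letterVec 𝒱 c) (letterVec 𝒱 c') A B) w = splitSum w fun m r =>
      sgn K ((p + wordParity (letterParity 𝒱) r) * (wordParity (letterParity 𝒱) m + p)) *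
        (evalWord A (m ++ [c]) * evalWord B (c' :: r)) := by
  by_cases h : w.length = k + l
  · obtain ⟨x, rfl⟩ := exists_eq_ofFn h
    rw [evalWord_ofFn, contractProd, signed_apply, plainProd_apply, splitSum,
      Finset.sum_eq_single k]
    · have h1 : (List.ofFn x).take k = List.ofFn (fun i => x (Fin.castAdd l i)) := by
        refine List.ext_getElem (by simp) fun i _ _ => ?_
        simp
      have h2 : (List.ofFn x).drop k = List.ofFn (fun i => x (Fin.natAdd k i)) := by
        refine List.ext_getElem (by simp) fun i _ _ => ?_
        simp
      rw [h1, h2, evalWord_append_singleton, evalWord_cons]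
      simp only [wordParity, List.map_ofFn, List.sum_ofFn, Function.comp_def]
      rfl
    · intro j hj hjk
      rw [evalWord_of_length_ne, zero_mul, mul_zero]
      simp at hj ⊢
      omega
    · intro hk
      simp at hk
  · rw [evalWord_of_length_ne _ h, splitSum_eq_zero]
    rintro u v rfl
    by_cases hu : u.length = k
    · rw [evalWord_of_length_ne B, mul_zero, mul_zero]
      simp at h ⊢; omega
    · rw [evalWord_of_length_ne A, zero_mul, mul_zero]
      simpa using hu

end Evaluation

/-! ### Splitting the inserted function by parity. -/

section ParityParts

variable {K L : Type*} [Field K] {q : L → ZMod 2}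

theorem splitSum_sum {ι : Type*} (s : Finset ι) (w : List L) (f : ι → List L → List L → K) :
    splitSum w (fun u v => ∑ i ∈ s, f i u v) = ∑ i ∈ s, splitSum w (f i) :=
  Finset.sum_comm

theorem shuffleSum_sum {ι : Type*} (s : Finset ι) (X Y : List L) (f : ι → List L → K) :
    shuffleSum q X Y (fun w => ∑ i ∈ s, f i w) = ∑ i ∈ s, shuffleSum q X Y (f i) := by
  classical
  induction s using Finset.induction_on with
  | empty => simpa using shuffleSum_zero q X Y
  | insert i s hi ih => simp only [Finset.sum_insert hi, shuffleSum_add, ih]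

variable (q) in
/-- The restriction of a function to the words of parity `a`. -/
def parityPart (a : ZMod 2) (A : List L → K) (w : List L) : K :=
  if wordParity q w = a then A w else 0

/-- All words of one shuffle have the same parity, so the restriction keeps or drops the whole sum.
-/
theorem VanishesOnShuffleSums.parityPart {A : List L → K} (hA : VanishesOnShuffleSums q A)
    (a : ZMod 2) : VanishesOnShuffleSums q (parityPart q a A) := by
  intro X Y hX hY
  by_cases h : wordParity q (X ++ Y) = a
  · rw [← hA X Y hX hY]
    exact shuffleSum_congr _ _ _ fun w hw => if_pos ((wordParity_perm q hw).trans h)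
  · exact shuffleSum_eq_zero _ _ _ fun w hw => if_neg fun h' =>
      h ((wordParity_perm q hw).symm.trans h')

/-- For each block `m` only `α = wordParity q m + q c` contributes. -/
theorem sum_insertSum_parityPart (t : ZMod 2 → K) (A : List L → K) (c : L) (B : List L → K)
    (w : List L) :
    ∑ α : ZMod 2, t α * insertSum q α (parityPart q (α + q c) A) c B w
      = splitSum w fun u w' => splitSum w' fun m v =>
          t (wordParity q m + q c) * (sgn K ((wordParity q m + q c) * wordParity q u) *
            (A m * B (u ++ c :: v))) := by
  simp only [insertSum, ← splitSum_mul, ← splitSum_sum]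
  refine splitSum_congr _ fun u w' _ => splitSum_congr _ fun m v _ => ?_
  rw [Finset.sum_eq_single (wordParity q m + q c)]
  · rw [parityPart, if_pos]
    linear_combination -CharTwo.add_self_eq_zero (q c)
  · intro α _ hα
    rw [parityPart, if_neg]
    · ring
    · intro h
      refine hα ?_
      rw [h]
      linear_combination -CharTwo.add_self_eq_zero (q c)
  · simp

/-- The coefficients depend on the word only through its parity, so they are constant along a
shuffle. -/
theorem vanishesOnShuffleSums_sum_insertSum {A B : List L → K} {c : L}
    (hA : VanishesOnShuffleSums q A) (hA0 : A [] = 0 ∨ ∀ m, m ≠ [] → A m = 0)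
    (hB : VanishesOnShuffleSums q B) (t : ZMod 2 → ZMod 2 → K) :
    VanishesOnShuffleSums q fun w => ∑ α : ZMod 2,
      t (wordParity q w) α * insertSum q α (parityPart q (α + q c) A) c B w := by
  intro X Y hX hY
  rw [shuffleSum_congr q X Y (g := fun w => ∑ α : ZMod 2, t (wordParity q (X ++ Y)) α *
      insertSum q α (parityPart q (α + q c) A) c B w)
      fun w hw => by rw [wordParity_perm q hw], shuffleSum_sum]
  refine Finset.sum_eq_zero fun α _ => ?_
  rw [shuffleSum_mul, (hA.parityPart _).insertSum ?_ ?_ hB X Y hX hY, mul_zero]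
  · refine hA0.imp (fun h => ?_) fun h m hm => ?_
    · simp [parityPart, h]
    · simp [parityPart, h m hm]
  · intro m hm
    by_contra h
    exact hm (if_neg h)

end ParityParts

/-! ### The bracket as a sum of two insertions. -/

section Bracket

variable {K V : Type*} [Field K] [AddCommGroup V] [Module K V] {𝒱 : ℤ → Submodule K V}

theorem IsCyclic.evalWord_append_comm {n : ℕ} {F : Form K V n} (hF : IsCyclic 𝒱 F)
    (u v : List (Letter 𝒱)) :
    evalWord F (u ++ v) = sgn K (wordParity (letterParity 𝒱) u * wordParity (letterParity 𝒱) v) *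
      evalWord F (v ++ u) := by
  induction u generalizing v with
  | nil => simp
  | cons a u ih =>
    have h1 := (isCyclic_iff F).1 hF (u ++ v) a
    have h2 := ih (v ++ [a])
    rw [← List.append_assoc, h1, List.append_assoc, List.singleton_append] at h2
    have h3 : evalWord F (a :: (u ++ v)) =
        sgn K (wordParity (letterParity 𝒱) (u ++ v) * letterParity 𝒱 a) *
        (sgn K (wordParity (letterParity 𝒱) (u ++ v) * letterParity 𝒱 a) *
        evalWord F (a :: (u ++ v))) := by
      rw [← mul_assoc, sgn_mul_sgn_self, one_mul]
    rw [List.cons_append, h3, h2, ← mul_assoc, ← sgn_add]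
    simp only [wordParity_append, wordParity_cons, wordParity_nil]
    congr 2
    linear_combination CharTwo.add_self_eq_zero
      (wordParity (letterParity 𝒱) u * letterParity 𝒱 a)

/-- The dichotomy between linear forms and forms with more arguments that
`VanishesOnShuffleSums.insertSum` requires. -/
theorem evalWord_append_support {k : ℕ} (A : Form K V (k + 1)) (c : Letter 𝒱) :
    evalWord A ([] ++ [c]) = 0 ∨ ∀ m : List (Letter 𝒱), m ≠ [] → evalWord A (m ++ [c]) = 0 := by
  cases k with
  | zero =>
    refine Or.inr fun m hm => evalWord_of_length_ne _ ?_
    simpa using hm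
  | succ k => exact Or.inl (evalWord_of_length_ne _ (by simp))

theorem evalWord_sum {ι : Type*} (s : Finset ι) {n : ℕ} (F : ι → Form K V n)
    (w : List (Letter 𝒱)) : evalWord (∑ i ∈ s, F i) w = ∑ i ∈ s, evalWord (F i) w := by
  unfold evalWord
  split_ifs <;> simp

theorem lof_mem_cyclicForms {n : ℕ} {F : Form K V n} (hF : IsCyclic 𝒱 F) :
    DirectSum.lof K ℕ (fun n => Form K V n) n F ∈ cyclicForms 𝒱 := by
  intro m
  by_cases h : n = m
  · subst h
    rwa [DirectSum.lof_apply]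
  · rw [DirectSum.lof_eq_of, DirectSum.of_eq_of_ne _ _ _ (Ne.symm h)]
    exact (cyclicForms 𝒱).zero_mem m

theorem lof_mem_vspForms {n : ℕ} {F : Form K V n} (hF : IsCyclic 𝒱 F)
    (hF' : VanishesOnShuffles 𝒱 F) :
    DirectSum.lof K ℕ (fun n => Form K V n) n F ∈ vspForms 𝒱 := by
  refine ⟨lof_mem_cyclicForms hF, fun m => ?_⟩
  by_cases h : n = m
  · subst h
    rwa [DirectSum.lof_apply]
  · rw [DirectSum.lof_eq_of, DirectSum.of_eq_of_ne _ _ _ (Ne.symm h)]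
    exact (vspForms 𝒱).zero_mem.2 m

variable [DirectSum.Decomposition 𝒱]

theorem evalWord_cyclicize_contractProd {k l : ℕ} (c c' : Letter 𝒱)
    (hc : letterParity 𝒱 c' = letterParity 𝒱 c) {A : Form K V (k + 1)} {B : Form K V (l + 1)}
    (hA : IsCyclic 𝒱 A) (hB : IsCyclic 𝒱 B) (X : List (Letter 𝒱)) (y : Letter 𝒱) :
    evalWord (cyclicize 𝒱
        (contractProd 𝒱 (letterParity 𝒱 c) (letterVec 𝒱 c) (letterVec 𝒱 c') A B)) (X ++ [y])
      = ∑ α : ZMod 2, sgn K (α * (wordParity (letterParity 𝒱) X + letterParity 𝒱 y + α)) *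
          insertSum (letterParity 𝒱) α (parityPart (letterParity 𝒱) (α + letterParity 𝒱 c')
            fun m => evalWord A (m ++ [c])) c' (fun w => evalWord B (w ++ [y])) X +
        ∑ α : ZMod 2, sgn K (letterParity 𝒱 c) *
          insertSum (letterParity 𝒱) α (parityPart (letterParity 𝒱) (α + letterParity 𝒱 c)
            fun m => evalWord B (m ++ [c'])) c (fun w => evalWord A (w ++ [y])) X := by
  rw [evalWord_cyclicize_append,
    sum_insertSum_parityPart (fun α => sgn K (α * (wordParity (letterParity 𝒱) X +
      letterParity 𝒱 y + α))), sum_insertSum_parityPart fun _ => sgn K (letterParity 𝒱 c),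
    ← splitSum_assoc X (fun u m v => sgn K (letterParity 𝒱 c) *
      (sgn K ((wordParity (letterParity 𝒱) m + letterParity 𝒱 c) * wordParity (letterParity 𝒱) u) *
        (evalWord B (m ++ [c']) * evalWord A (u ++ c :: v ++ [y])))), ← splitSum_add]
  refine splitSum_congr _ fun u v hX => ?_
  rw [evalWord_contractProd, splitSum_append_cons, mul_add, ← splitSum_mul, ← splitSum_mul]
  subst hX
  congr 1
  -- Here `y` falls to `B`, with `v = m ++ r`: rotating `(c', r, y, u)` to `(u, c', r, y)` exhibits
  -- `m` as the block replaced by `c'`.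
  · refine splitSum_congr _ fun m r hv => ?_
    subst hv
    have h := hB.evalWord_append_comm (c' :: (r ++ [y])) u
    have e : c' :: (r ++ y :: u) = c' :: (r ++ [y]) ++ u := by simp
    rw [e, h]
    simp only [hc, wordParity_append, wordParity_cons, wordParity_nil, add_zero,
      List.append_assoc, List.cons_append]
    generalize evalWord A _ = s, evalWord B _ = s'
    generalize wordParity (letterParity 𝒱) u = a, wordParity (letterParity 𝒱) m = b,
      wordParity (letterParity 𝒱) r = d, letterParity 𝒱 c = p, letterParity 𝒱 y = z
    -- Comparing the total Koszul signs is a finite check in the five parities.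
    have : ∀ a b d p z : ZMod 2, a * (b + d + z) + (p + (d + (z + a))) * (b + p) + (p + (d + z)) * a
        = (b + p) * (a + (b + d) + z + (b + p)) + (b + p) * a := by decide
    have := congrArg (sgn K) (this a b d p z)
    rw [sgn_add, sgn_add, sgn_add] at this
    linear_combination s * s' * this
  -- Here `y` falls to `A`, with `u = m ++ r`: `A` is rotated to `(m, c, v, y)` and `B` to `(r,
  -- c')`, so `r` is the block replaced by `c`.
  · refine splitSum_congr _ fun m r hu => ?_
    subst hu
    have h := hA.evalWord_append_comm (v ++ [y]) (m ++ [c])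
    have h' := hB.evalWord_append_comm [c'] r
    have e : v ++ y :: m ++ [c] = v ++ [y] ++ (m ++ [c]) := by simp
    rw [List.singleton_append] at h'
    rw [e, h, h']
    simp only [hc, wordParity_append, wordParity_cons, wordParity_nil, add_zero,
      List.append_assoc, List.cons_append, List.nil_append]
    generalize evalWord A _ = s, evalWord B _ = s'
    generalize wordParity (letterParity 𝒱) v = a, wordParity (letterParity 𝒱) m = b,
      wordParity (letterParity 𝒱) r = d, letterParity 𝒱 c = p, letterParity 𝒱 y = z
    have : ∀ a b d p z : ZMod 2, (b + d) * (a + z) + (p + d) * (a + (z + b) + p) +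
        (a + z) * (b + p) + p * d = p + (d + p) * b := by decide
    have := congrArg (sgn K) (this a b d p z)
    rw [sgn_add, sgn_add, sgn_add, sgn_add p] at this
    linear_combination s * s' * this

theorem vanishesOnShuffles_cyclicize_contractProd {k l : ℕ} (c c' : Letter 𝒱)
    (hc : letterParity 𝒱 c' = letterParity 𝒱 c) {A : Form K V (k + 1)} {B : Form K V (l + 1)}
    (hA : IsCyclic 𝒱 A) (hB : IsCyclic 𝒱 B)
    (hA' : VanishesOnShuffles 𝒱 A) (hB' : VanishesOnShuffles 𝒱 B) :
    VanishesOnShuffles 𝒱 (cyclicize 𝒱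
      (contractProd 𝒱 (letterParity 𝒱 c) (letterVec 𝒱 c) (letterVec 𝒱 c') A B)) := by
  rw [vanishesOnShuffles_iff] at hA' hB' ⊢
  intro y X Y hX hY
  simp only [evalWord_cyclicize_contractProd c c' hc hA hB]
  rw [shuffleSum_add,
    vanishesOnShuffleSums_sum_insertSum (hA' c) (evalWord_append_support A c) (hB' y)
      (fun s α => sgn K (α * (s + letterParity 𝒱 y + α))) X Y hX hY,
    vanishesOnShuffleSums_sum_insertSum (hB' c') (evalWord_append_support B c') (hA' y)
      (fun _ _ => sgn K (letterParity 𝒱 c)) X Y hX hY, add_zero]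

theorem isCyclic_pieceFun {ι : Type*} [Fintype ι] (e e' : ι → V) (d : ι → ℤ) {k l : ℕ}
    (A : Form K V (k + 1)) (B : Form K V (l + 1)) : IsCyclic 𝒱 (pieceFun 𝒱 e e' d A B) := by
  rw [isCyclic_iff]
  intro w a
  simp only [pieceFun, evalWord_sum, Finset.mul_sum]
  exact Finset.sum_congr rfl fun i _ => (isCyclic_iff _).1 (isCyclic_cyclicize _) w a

theorem parity_neg (d : ℤ) : parity (-d) = parity d := by
  simp [parity, CharTwo.neg_eq]

theorem vanishesOnShuffles_pieceFun {ι : Type*} [Fintype ι] {e e' : ι → V} {d : ι → ℤ}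
    (he : ∀ i, e i ∈ 𝒱 (d i)) (he' : ∀ i, e' i ∈ 𝒱 (-d i)) {k l : ℕ}
    {A : Form K V (k + 1)} {B : Form K V (l + 1)} (hA : IsCyclic 𝒱 A) (hB : IsCyclic 𝒱 B)
    (hA' : VanishesOnShuffles 𝒱 A) (hB' : VanishesOnShuffles 𝒱 B) :
    VanishesOnShuffles 𝒱 (pieceFun 𝒱 e e' d A B) := by
  rw [vanishesOnShuffles_iff]
  intro y X Y hX hY
  simp only [pieceFun, evalWord_sum]
  rw [shuffleSum_sum]
  refine Finset.sum_eq_zero fun i _ => ?_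
  exact (vanishesOnShuffles_iff _).1 (vanishesOnShuffles_cyclicize_contractProd
    (⟨d i, e i, he i⟩ : Letter 𝒱) ⟨-d i, e' i, he' i⟩ (parity_neg _) hA hB hA' hB') y X Y hX hY

theorem bracket_mem {ι : Type*} [Fintype ι] (e e' : ι → V) (d : ι → ℤ)
    (S : Submodule K (Forms K V)) (Ω Ω' : Forms K V)
    (h : ∀ k l, DirectSum.lof K ℕ (fun n => Form K V n) (k + l)
      (pieceFun 𝒱 e e' d (Ω (k + 1)) (Ω' (l + 1))) ∈ S) :
    bracket 𝒱 e e' d Ω Ω' ∈ S := by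
  classical
  have hp : ∀ m n, bracketPiece 𝒱 e e' d m n (Ω m) (Ω' n) ∈ S := by
    intro m n
    cases m with
    | zero => simp [bracketPiece]
    | succ k =>
      cases n with
      | zero => simp [bracketPiece]
      | succ l => exact h k l
  rw [← DirectSum.sum_support_of Ω, ← DirectSum.sum_support_of Ω']
  simp only [map_sum, LinearMap.sum_apply]
  refine Submodule.sum_mem _ fun m _ => Submodule.sum_mem _ fun n _ => ?_
  simp only [bracket, ← DirectSum.lof_eq_of K, DirectSum.toModule_lof, LinearMap.flip_apply]
  exact hp _ _

/-- The dual basis of a homogeneous basis with respect to a form of degree `0` is homogeneous. -/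
theorem dual_basis_mem {b : LinearMap.BilinForm K V}
    (hb_deg : ∀ (m n : ℤ), ∀ x ∈ 𝒱 m, ∀ y ∈ 𝒱 n, m + n ≠ 0 → b x y = 0)
    {ι : Type*} [Fintype ι] [DecidableEq ι] {e : ι → V} {d : ι → ℤ}
    (he : ∀ i, e i ∈ 𝒱 (d i)) (e' : Module.Basis ι K V)
    (he' : ∀ i j, b (e i) (e' j) = if i = j then 1 else 0) (j : ι) : e' j ∈ 𝒱 (-d j) := by
  -- Pairing with `e i` sees only the component of degree `-d i`; and by `hrepr` these pairings are
  -- the coordinates with respect to `e'`.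
  have hproj : ∀ i x, b (e i) (DirectSum.decompose 𝒱 x (-d i)) = b (e i) x := by
    intro i x
    induction x using DirectSum.Decomposition.inductionOn 𝒱 with
    | zero => simp
    | @homogeneous m x =>
      by_cases h : m = -d i
      · subst h
        rw [DirectSum.decompose_of_mem_same 𝒱 x.2]
      · rw [DirectSum.decompose_of_mem_ne 𝒱 x.2 h, map_zero,
          hb_deg _ _ _ (he i) _ x.2 (by omega)]
    | add x y hx hy => simp [hx, hy]
  have hrepr : ∀ i x, b (e i) x = e'.repr x i := by
    intro i x
    conv_lhs => rw [← e'.sum_repr x, map_sum]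
    simp only [map_smul, he', smul_eq_mul, mul_ite, mul_one, mul_zero, Finset.sum_ite_eq,
      Finset.mem_univ, if_true]
  have : e' j = DirectSum.decompose 𝒱 (e' j) (-d j) := by
    refine e'.ext_elem fun i => ?_
    rw [← hrepr, ← hrepr]
    -- If the degrees differ, both coordinates vanish: one by degree, the other because `i ≠ j`.
    by_cases h : d i = d j
    · rw [← h, hproj]
    · rw [hb_deg _ _ _ (he i) _ (Subtype.prop _) (by omega), he', if_neg]
      rintro rfl
      exact h rfl
  rw [this]
  exact Subtype.prop _

end Bracket

end CyclicForms

theorem mainTheorem3 {K V : Type*} [Field K] [CharZero K] [AddCommGroup V] [Module K V]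
    [FiniteDimensional K V] (𝒱 : ℤ → Submodule K V) [DirectSum.Decomposition 𝒱]
    (b : LinearMap.BilinForm K V) (hb_nondeg : b.Nondegenerate)
    (hb_symm : ∀ (m n : ℤ), ∀ x ∈ 𝒱 m, ∀ y ∈ 𝒱 n, b x y = (-1 : K) ^ (m * n) * b y x)
    (hb_deg : ∀ (m n : ℤ), ∀ x ∈ 𝒱 m, ∀ y ∈ 𝒱 n, m + n ≠ 0 → b x y = 0)
    {ι : Type*} [Fintype ι] [DecidableEq ι] (e : Module.Basis ι K V) (d : ι → ℤ)
    (he : ∀ i, e i ∈ 𝒱 (d i)) (e' : Module.Basis ι K V)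
    (he' : ∀ i j, b (e i) (e' j) = if i = j then 1 else 0) :
    (∀ Ω ∈ CyclicForms.cyclicForms 𝒱, ∀ Ω' ∈ CyclicForms.cyclicForms 𝒱,
      CyclicForms.bracket 𝒱 e e' d Ω Ω' ∈ CyclicForms.cyclicForms 𝒱) ∧
    CyclicForms.vspForms 𝒱 ≤ CyclicForms.cyclicForms 𝒱 ∧
    (∀ Ω ∈ CyclicForms.vspForms 𝒱, ∀ Ω' ∈ CyclicForms.vspForms 𝒱,
      CyclicForms.bracket 𝒱 e e' d Ω Ω' ∈ CyclicForms.vspForms 𝒱) := by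
  refine ⟨fun Ω _ Ω' _ => ?_, fun Ω h => h.1, fun Ω h Ω' h' => ?_⟩
  · exact CyclicForms.bracket_mem _ _ _ _ _ _ fun k l =>
      CyclicForms.lof_mem_cyclicForms (CyclicForms.isCyclic_pieceFun _ _ _ _ _)
  · exact CyclicForms.bracket_mem _ _ _ _ _ _ fun k l =>
      CyclicForms.lof_mem_vspForms (CyclicForms.isCyclic_pieceFun _ _ _ _ _)
        (CyclicForms.vanishesOnShuffles_pieceFun he
          (CyclicForms.dual_basis_mem hb_deg he e' he') (h.1 _) (h'.1 _) (h.2 _) (h'.2 _))
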